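/- Let $d\ge 1$, $\sigma>0$, $\omega>0$, and let $\ell^2=\ell^2(\mathbb Z^d)$. For real $u\in\ell^2$ write $(\Delta_{disc}u)_n=\sum_{|j-n|=1}u_j-2d\,u_n$ and $$J_\omega[u]=\sum_{\{n,j\}:\,|j-n|=1}|u_j-u_n|^2+\omega\sum_{n}|u_n|^2 ,\qquad j(\omega)=\inf\Big\{J_\omega[u]:\ u\in\ell^2,\ \sum_n|u_n|^{2\sigma+2}=1\Big\},$$ where the first sum is over unordered pairs of nearest neighbours in $\mathbb Z^d$ (each pair counted once), so that it equals $\langle-\Delta_{disc}u,u\rangle$. Let $u_\omega\in\ell^2$ be a limit wave: there are $\delta_j\to0$, $\delta_j\neq0$, and constrained minimizers $u_{\omega+\delta_j}$ of $J_{\omega+\delta_j}$ subject to $\sum_n|u_n|^{2\sigma+2}=1$ such that $\|u_{\omega+\delta_j}-u_\omega\|_{\ell^2}\to0$. Put $\varphi_\omega=j(\omega)^{1/(2\sigma)}u_\omega$ and $\varphi_{\omega+\delta_j}=j(\omega+\delta_j)^{1/(2\sigma)}u_{\omega+\delta_j}$, and define, on real or complex $\ell^2$, $$\mathcal L_+=-\Delta_{disc}+\omega-(2\sigma+1)|\varphi_\omega|^{2\sigma},\qquad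 \mathcal L_-=-\Delta_{disc}+\omega-|\varphi_\omega|^{2\sigma}.$$ Call the standing wave $e^{i\omega t}\varphi_\omega$ of the equation $i\partial_tu+\Delta_{disc}u+|u|^{2\sigma}u=0$ spectrally stable if there are no $\mu\in\mathbb C$ with $\Re\mu>0$ and $(f,g)\neq(0,0)$ in $\ell^2(\mathbb Z^d;\mathbb C)^2$ such that $-\mathcal L_-g=\mu f$ and $\mathcal L_+f=\mu g$, and unstable otherwise. Assume that $\varphi_\omega$ is non-degenerate: $\ker\mathcal L_+=\{0\}$ in $\ell^2$. Then $\mathcal L_+$ has a bounded inverse on $\ell^2$, the limit $$\lim_{j\to\infty}\frac{\|\varphi_{\omega+\delta_j}\|_{\ell^2}^2-\|\varphi_\omega\|_{\ell^2}^2}{\delta_j}=-2\langle\mathcal L_+^{-1}\varphi_\omega,\varphi_\omega\rangle$$ exists, and $e^{i\omega t}\varphi_\omega$ is spectrally stable if this limit is $\ge0$ and unstable if it is $<0$. -/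

import Mathlib

open Filter Topology

noncomputable section

namespace DNLS

/-- The lattice `ℤ^d`. -/
abbrev Lattice (d : ℕ) : Type := Fin d → ℤ

/-- Square summable sequences on `ℤ^d` with values in `E` (here `E = ℝ` or `E = ℂ`). -/
abbrev L2 (d : ℕ) (E : Type) [NormedAddCommGroup E] : Type :=
  lp (fun _ : Lattice d => E) 2

/-- The `i`-th unit vector of `ℤ^d`. The sites at distance one from `n` are `n ± basisVec i`. -/
def basisVec {d : ℕ} (i : Fin d) : Lattice d := Pi.single i 1

/-- The discrete Laplacian `∑_{|j-n|=1} u_j - 2d u_n`. -/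
def discLaplacian {d : ℕ} {E : Type} [AddCommGroup E] [Module ℝ E]
    (u : Lattice d → E) (n : Lattice d) : E :=
  (∑ i : Fin d, (u (n + basisVec i) + u (n - basisVec i))) - (2 * (d : ℝ)) • u n

/-- `J[u] = ∑ |u_j - u_n|^2 + ω ∑ |u_n|^2`, the first sum being over all nearest-neighbour
pairs of sites, each pair counted once. Both sums converge for square summable `u`. -/
def energy {d : ℕ} (ω : ℝ) (u : L2 d ℝ) : ℝ :=
  (∑' n : Lattice d, ∑ i : Fin d, |u (n + basisVec i) - u n| ^ 2)
    + ω * ∑' n : Lattice d, |u n| ^ 2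

/-- The constraint `∑ |u_n|^{2σ+2} = 1` (the sum converges for square summable `u` and
`σ > 0`). -/
def Constraint {d : ℕ} (σ : ℝ) (u : L2 d ℝ) : Prop :=
  ∑' n : Lattice d, |u n| ^ (2 * σ + 2) = 1

/-- Constrained minimizers of `J`. -/
def IsMinimizer {d : ℕ} (σ ω : ℝ) (u : L2 d ℝ) : Prop :=
  Constraint σ u ∧ ∀ w : L2 d ℝ, Constraint σ w → energy ω u ≤ energy ω w

/-- `j(ω)`, the infimum of `J` under the constraint. -/
def minValue (d : ℕ) (σ ω : ℝ) : ℝ :=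
  sInf {e : ℝ | ∃ w : L2 d ℝ, Constraint σ w ∧ e = energy ω w}

/-- The rescaled wave `φ = j(ω)^{1/(2σ)} u`. -/
def wave {d : ℕ} (σ ω : ℝ) (u : L2 d ℝ) : L2 d ℝ :=
  (minValue d σ ω) ^ (1 / (2 * σ)) • u

/-- `u` is a limit wave at frequency `ω`, as witnessed by the increments `δ_j → 0`, `δ_j ≠ 0`,
and by the minimizers `v_j` at the frequencies `ω + δ_j`. -/
structure IsLimitWaveAlong {d : ℕ} (σ ω : ℝ) (δ : ℕ → ℝ) (v : ℕ → L2 d ℝ) (u : L2 d ℝ) :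
    Prop where
  increment_ne_zero : ∀ j, δ j ≠ 0
  increment_tendsto : Tendsto δ atTop (𝓝 0)
  isMinimizer : ∀ j, IsMinimizer σ (ω + δ j) (v j)
  wave_tendsto : Tendsto v atTop (𝓝 u)

/-- `L_+ f = -Δ f + ω f - (2σ+1) |φ|^{2σ} f`. -/
def Lplus {d : ℕ} {E : Type} [AddCommGroup E] [Module ℝ E]
    (σ ω : ℝ) (φ : Lattice d → ℝ) (f : Lattice d → E) (n : Lattice d) : E :=
  -discLaplacian f n + ω • f n - ((2 * σ + 1) * |φ n| ^ (2 * σ)) • f n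

/-- `L_- f = -Δ f + ω f - |φ|^{2σ} f`. -/
def Lminus {d : ℕ} {E : Type} [AddCommGroup E] [Module ℝ E]
    (σ ω : ℝ) (φ : Lattice d → ℝ) (f : Lattice d → E) (n : Lattice d) : E :=
  -discLaplacian f n + ω • f n - (|φ n| ^ (2 * σ)) • f n

/-- Spectral stability of `e^{iωt} φ`: the linearized problem `-L_- g = μ f`, `L_+ f = μ g`
has no nonzero solution `(f, g)` in complex `ℓ² × ℓ²` with `Re μ > 0`. -/
def SpectrallyStable {d : ℕ} (σ ω : ℝ) (φ : Lattice d → ℝ) : Prop :=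
  ¬ ∃ (μ : ℂ) (f g : L2 d ℂ), 0 < μ.re ∧ (f ≠ 0 ∨ g ≠ 0) ∧
    (∀ n, -Lminus σ ω φ (fun m => g m) n = μ * f n) ∧
    (∀ n, Lplus σ ω φ (fun m => f m) n = μ * g n)

end DNLS

end

/-! Strong convergence makes the limit `u` itself a minimizer at `ω`. Comparing `u` with rescaled
competitors gives three facts about `φ`. The Euler–Lagrange equation is `L_- φ = 0`. The second
variation gives `L_+ ≥ 0` on the orthogonal complement of `χ = |φ|^{2σ} φ`. Young's inequality,
applied site by site, gives `L_- ≥ 0`. A Perron–Frobenius argument then shows `ker L_- = span φ`.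
Both operators are the coercive operator `-Δ + ω` minus a compact multiplication, so the Fredholm
alternative applies and non-degeneracy makes `L_+` invertible.

Subtracting the wave equations at `ω + δ_j` and `ω` gives `L_+(φ_{ω+δ_j} - φ) + δ_j φ_{ω+δ_j} =
o(‖φ_{ω+δ_j} - φ‖)`. Hence the difference quotient of the waves tends to `-L_+⁻¹ φ`, and the slope
of the squared norm is `-2⟨L_+⁻¹ φ, φ⟩`.

The sign of `⟨L_+⁻¹ φ, φ⟩` decides whether `L_+` is nonnegative on the complement of `φ`
(`nonneg_on_orthogonal`, `exists_neg_on_orthogonal`). If it is, a growing mode has `f ⊥ φ`, and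
pairing the two equations with `g` and `f` gives quantities of opposite sign, which forces the mode
to vanish (`no_growing_mode`). If it is not, take the least `l` for which `L_- L_+ L_- + l L_-` is
nonnegative. At this threshold the form has a null vector outside `ker L_-`, which yields a mode
with `μ = √l` (`exists_growing_mode`). -/

namespace DNLS

/-! ### Symmetric operators on a real Hilbert space: Fredholm alternative and the stability
dichotomy. -/

section Abstract

variable {H : Type*} [NormedAddCommGroup H] [InnerProductSpace ℝ H]

open scoped InnerProductSpace

/-- The Cauchy-Schwarz inequality for a nonnegative symmetric operator. -/
theorem norm_map_sq_le_of_nonneg {T : H →L[ℝ] H} (hsym : ∀ x y, ⟪T x, y⟫_ℝ = ⟪x, T y⟫_ℝ)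
    (hpos : ∀ x, 0 ≤ ⟪T x, x⟫_ℝ) (x : H) : ‖T x‖ ^ 2 ≤ (‖T‖ + 1) * ⟪T x, x⟫_ℝ := by
  -- The form is tested on `N x - T x`; the extra `1` keeps `N` positive when `T = 0`.
  set N := ‖T‖ + 1 with hN
  have hN0 : 0 < N := by positivity
  have h := hpos (N • x - T x)
  have h1 : ⟪T (T x), T x⟫_ℝ ≤ N * ‖T x‖ ^ 2 := by
    have h2 := real_inner_le_norm (T (T x)) (T x)
    have h3 := T.le_opNorm (T x)
    nlinarith [norm_nonneg (T x)]
  have h2 : ⟪T (N • x - T x), N • x - T x⟫_ℝ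
      = N ^ 2 * ⟪T x, x⟫_ℝ - 2 * N * ‖T x‖ ^ 2 + ⟪T (T x), T x⟫_ℝ := by
    simp only [map_sub, map_smul, inner_sub_left, inner_sub_right, inner_smul_left,
      inner_smul_right, hsym (T x) x, real_inner_self_eq_norm_sq, conj_trivial]
    ring
  rw [h2] at h
  have h3 : 0 ≤ N * (N * ⟪T x, x⟫_ℝ - ‖T x‖ ^ 2) := by nlinarith
  have := nonneg_of_mul_nonneg_right h3 hN0
  linarith

/-- The inverse bounds `‖x‖` by `‖T x‖`, and the preceding Cauchy–Schwarz inequality bounds `‖T x‖²`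
by the quadratic form. -/
theorem coercive_of_nonneg_of_isUnit {T : H →L[ℝ] H} (hsym : ∀ x y, ⟪T x, y⟫_ℝ = ⟪x, T y⟫_ℝ)
    (hpos : ∀ x, 0 ≤ ⟪T x, x⟫_ℝ) (hT : IsUnit T) :
    ∃ c > 0, ∀ x, c * ‖x‖ ^ 2 ≤ ⟪T x, x⟫_ℝ := by
  obtain ⟨t, rfl⟩ := hT
  set T : H →L[ℝ] H := ↑t
  set R : H →L[ℝ] H := ↑t⁻¹ with hR
  have hRT : ∀ x, R (T x) = x := fun x => by
    rw [← mul_apply_eq_comp, Units.inv_mul]; rfl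
  have hpos' : 0 < (‖R‖ + 1) ^ 2 * (‖T‖ + 1) := by positivity
  refine ⟨((‖R‖ + 1) ^ 2 * (‖T‖ + 1))⁻¹, by positivity, fun x => ?_⟩
  have h1 := norm_map_sq_le_of_nonneg hsym hpos x
  have h2 : ‖x‖ ≤ (‖R‖ + 1) * ‖T x‖ := by
    have := R.le_opNorm (T x)
    rw [hRT] at this
    nlinarith [norm_nonneg (T x)]
  have h3 : ‖x‖ ^ 2 ≤ (‖R‖ + 1) ^ 2 * ‖T x‖ ^ 2 := by
    rw [← mul_pow]; exact pow_le_pow_left₀ (norm_nonneg _) h2 2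
  rw [inv_mul_le_iff₀ hpos', mul_assoc]
  exact h3.trans (mul_le_mul_of_nonneg_left h1 (by positivity))

theorem map_eq_zero_of_inner_eq_zero {T : H →L[ℝ] H} (hsym : ∀ x y, ⟪T x, y⟫_ℝ = ⟪x, T y⟫_ℝ)
    (hpos : ∀ x, 0 ≤ ⟪T x, x⟫_ℝ) {x : H} (hx : ⟪T x, x⟫_ℝ = 0) : T x = 0 := by
  have h := norm_map_sq_le_of_nonneg hsym hpos x
  rw [hx, mul_zero] at h
  simpa using le_antisymm h (by positivity)

/-- The constrained second variation and the sign of `⟪ψ, φ⟫`, `Lp ψ = φ`, decide whether `Lp` is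
nonnegative on the orthogonal complement of `φ`. -/
theorem nonneg_on_orthogonal {Lp : H →L[ℝ] H} (hsym : ∀ x y, ⟪Lp x, y⟫_ℝ = ⟪x, Lp y⟫_ℝ)
    {φ ψ χ : H} (hψ : Lp ψ = φ) (hχ : ∀ v, ⟪v, χ⟫_ℝ = 0 → 0 ≤ ⟪Lp v, v⟫_ℝ)
    (hψχ : ⟪ψ, χ⟫_ℝ ≠ 0) (hS : ⟪ψ, φ⟫_ℝ ≤ 0) {v : H} (hv : ⟪v, φ⟫_ℝ = 0) :
    0 ≤ ⟪Lp v, v⟫_ℝ := by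
  -- Moving along `ψ` makes `v` orthogonal to `χ`. The cross term is `⟪v, φ⟫ = 0`, so the form
  -- changes only by `t² ⟪ψ, φ⟫ ≤ 0`.
  set t := ⟪v, χ⟫_ℝ / ⟪ψ, χ⟫_ℝ with ht
  have h := hχ (v - t • ψ) (by
    rw [inner_sub_left, inner_smul_left, ht]
    simp only [conj_trivial]
    field_simp
    simp)
  have h2 : ⟪Lp (v - t • ψ), v - t • ψ⟫_ℝ = ⟪Lp v, v⟫_ℝ + t ^ 2 * ⟪ψ, φ⟫_ℝ := by
    simp only [map_sub, map_smul, inner_sub_left, inner_sub_right, inner_smul_left,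
      inner_smul_right, conj_trivial, hsym v ψ, hψ, hv, real_inner_comm v φ, real_inner_comm ψ φ]
    rw [real_inner_comm] at hv
    ring
  rw [h2] at h
  nlinarith [sq_nonneg t]

/-- Projecting the negative direction `φ` along `ψ` onto the complement of `φ` lowers the form
further, by `t ‖φ‖²`. -/
theorem exists_neg_on_orthogonal {Lp : H →L[ℝ] H} (hsym : ∀ x y, ⟪Lp x, y⟫_ℝ = ⟪x, Lp y⟫_ℝ)
    {φ ψ : H} (hψ : Lp ψ = φ) (hφ : ⟪Lp φ, φ⟫_ℝ < 0) (hS : 0 < ⟪ψ, φ⟫_ℝ) :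
    ∃ v, ⟪v, φ⟫_ℝ = 0 ∧ ⟪Lp v, v⟫_ℝ < 0 := by
  set t := ⟪φ, φ⟫_ℝ / ⟪ψ, φ⟫_ℝ with ht
  refine ⟨φ - t • ψ, ?_, ?_⟩
  · rw [inner_sub_left, inner_smul_left, ht]
    simp only [conj_trivial]
    field_simp
    simp
  · have h2 : ⟪Lp (φ - t • ψ), φ - t • ψ⟫_ℝ
        = ⟪Lp φ, φ⟫_ℝ - 2 * t * ⟪φ, φ⟫_ℝ + t ^ 2 * ⟪ψ, φ⟫_ℝ := by
      simp only [map_sub, map_smul, inner_sub_left, inner_sub_right, inner_smul_left,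
        inner_smul_right, conj_trivial, hsym φ ψ, hψ, real_inner_comm ψ φ]
      ring
    have h3 : t * ⟪ψ, φ⟫_ℝ = ⟪φ, φ⟫_ℝ := by rw [ht]; field_simp
    rw [h2]
    have h4 : 0 ≤ t * ⟪φ, φ⟫_ℝ :=
      mul_nonneg (div_nonneg real_inner_self_nonneg hS.le) real_inner_self_nonneg
    have h5 : t ^ 2 * ⟪ψ, φ⟫_ℝ = t * ⟪φ, φ⟫_ℝ := by linear_combination t * h3
    linarith

/-- Stability: the linearized problem, written for real and imaginary parts, has no growing mode
when `Lp` is nonnegative on the orthogonal complement of the kernel element `φ` of `Lm ≥ 0`. -/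
theorem no_growing_mode {Lp Lm : H →L[ℝ] H} (hLp : ∀ x y, ⟪Lp x, y⟫_ℝ = ⟪x, Lp y⟫_ℝ)
    (hLm : ∀ x y, ⟪Lm x, y⟫_ℝ = ⟪x, Lm y⟫_ℝ) (hpos : ∀ x, 0 ≤ ⟪Lm x, x⟫_ℝ) {φ : H}
    (hφ : Lm φ = 0) (hLpφ : ∀ v, ⟪v, φ⟫_ℝ = 0 → 0 ≤ ⟪Lp v, v⟫_ℝ) {α β : ℝ} (hα : 0 < α)
    {f₁ f₂ g₁ g₂ : H} (h1 : -Lm g₁ = α • f₁ - β • f₂) (h2 : -Lm g₂ = α • f₂ + β • f₁)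
    (h3 : Lp f₁ = α • g₁ - β • g₂) (h4 : Lp f₂ = α • g₂ + β • g₁) :
    f₁ = 0 ∧ f₂ = 0 ∧ g₁ = 0 ∧ g₂ = 0 := by
  have hne : 0 < α ^ 2 + β ^ 2 := by positivity
  -- Multiplication by `α + iβ ≠ 0` is injective on `x + iy`: multiply by the conjugate.
  have solve : ∀ x y : H, α • x - β • y = 0 → α • y + β • x = 0 → x = 0 ∧ y = 0 := by
    intro x y hx hy
    constructor
    · have : (α ^ 2 + β ^ 2) • x = α • (α • x - β • y) + β • (α • y + β • x) := by module
      rw [hx, hy, smul_zero, smul_zero, add_zero] at this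
      exact (smul_eq_zero.1 this).resolve_left hne.ne'
    · have : (α ^ 2 + β ^ 2) • y = α • (α • y + β • x) - β • (α • x - β • y) := by module
      rw [hx, hy, smul_zero, smul_zero, sub_zero] at this
      exact (smul_eq_zero.1 this).resolve_left hne.ne'
  have e1 : α * ⟪f₁, φ⟫_ℝ - β * ⟪f₂, φ⟫_ℝ = 0 := by
    have := congrArg (fun z => ⟪z, φ⟫_ℝ) h1
    simpa [inner_sub_left, inner_smul_left, hLm, hφ, inner_neg_left] using this.symm
  have e2 : α * ⟪f₂, φ⟫_ℝ + β * ⟪f₁, φ⟫_ℝ = 0 := by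
    have := congrArg (fun z => ⟪z, φ⟫_ℝ) h2
    simpa [inner_add_left, inner_smul_left, hLm, hφ, inner_neg_left] using this.symm
  have f1φ : ⟪f₁, φ⟫_ℝ = 0 := by
    have : (α ^ 2 + β ^ 2) * ⟪f₁, φ⟫_ℝ = 0 := by linear_combination α * e1 + β * e2
    exact (mul_eq_zero.1 this).resolve_left hne.ne'
  have f2φ : ⟪f₂, φ⟫_ℝ = 0 := by
    have : (α ^ 2 + β ^ 2) * ⟪f₂, φ⟫_ℝ = 0 := by linear_combination α * e2 - β * e1
    exact (mul_eq_zero.1 this).resolve_left hne.ne'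
  have a1 := hLpφ _ f1φ
  have a2 := hLpφ _ f2φ
  have b1 := hpos g₁
  have b2 := hpos g₂
  have h1' : Lm g₁ = -(α • f₁ - β • f₂) := by rw [← h1, neg_neg]
  have h2' : Lm g₂ = -(α • f₂ + β • f₁) := by rw [← h2, neg_neg]
  have sp := hLp f₁ f₂
  have sm := hLm g₁ g₂
  have b1' := b1
  have b2' := b2
  rw [h3] at a1 sp
  rw [h4] at a2 sp
  rw [h1'] at b1' sm
  rw [h2'] at b2' sm
  simp only [inner_sub_left, inner_add_left, inner_neg_left, inner_neg_right,
    inner_add_right, inner_smul_left, inner_smul_right, conj_trivial, real_inner_comm f₁ g₁,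
    real_inner_comm f₂ g₁, real_inner_comm f₁ g₂, real_inner_comm f₂ g₂] at a1 a2 b1' b2' sp sm
  -- `p + iq` is the Hermitian product of `f` and `g`. Symmetry of `Lp` reads `αq = βp` and symmetry
  -- of `Lm` reads `αq = -βp`, so `q = 0`. The forms of `Lp` at `f` and of `Lm` at `g` are then `αp`
  -- and `-αp`; both are nonnegative, hence zero.
  set p := ⟪f₁, g₁⟫_ℝ + ⟪f₂, g₂⟫_ℝ with hp
  set q := ⟪f₂, g₁⟫_ℝ - ⟪f₁, g₂⟫_ℝ with hq
  have hαq : α * q = 0 := by rw [hq]; linarith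
  have hq0 : q = 0 := (mul_eq_zero.1 hαq).resolve_left hα.ne'
  have hA : 0 ≤ α * p + β * q := by rw [hp, hq]; linarith
  have hB : 0 ≤ -(α * p) + β * q := by rw [hp, hq]; linarith
  rw [hq0, mul_zero, add_zero] at hA hB
  have hsum : ⟪Lm g₁, g₁⟫_ℝ + ⟪Lm g₂, g₂⟫_ℝ = -(α * p) + β * q := by
    rw [h1', h2', hp, hq]
    simp only [inner_sub_left, inner_add_left, inner_neg_left, inner_smul_left, conj_trivial]
    ring
  rw [hq0, mul_zero, add_zero] at hsum
  have z1 : Lm g₁ = 0 := map_eq_zero_of_inner_eq_zero hLm hpos (by linarith)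
  have z2 : Lm g₂ = 0 := map_eq_zero_of_inner_eq_zero hLm hpos (by linarith)
  rw [z1, neg_zero] at h1
  rw [z2, neg_zero] at h2
  obtain ⟨hf1, hf2⟩ := solve f₁ f₂ h1.symm h2.symm
  rw [hf1, map_zero] at h3
  rw [hf2, map_zero] at h4
  obtain ⟨hg1, hg2⟩ := solve g₁ g₂ h3.symm h4.symm
  exact ⟨hf1, hf2, hg1, hg2⟩

theorem isCompactOperator_rankOne (φ : H) :
    IsCompactOperator (InnerProductSpace.rankOne ℝ φ φ) := by
  have h := (isCompactOperator_of_locallyCompactSpace_dom (innerSL ℝ φ)).clm_comp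
    ((ContinuousLinearMap.id ℝ ℝ).smulRight φ)
  have he : ⇑(InnerProductSpace.rankOne ℝ φ φ)
      = ⇑((ContinuousLinearMap.id ℝ ℝ).smulRight φ) ∘ ⇑((innerSL ℝ) φ) := by
    funext x
    simp
  rw [he]
  exact h

variable [CompleteSpace H]

/-- The Lax–Milgram theorem in operator form. -/
theorem isUnit_of_coercive {B : H →L[ℝ] H} {c : ℝ} (hc : 0 < c)
    (hB : ∀ x, c * ‖x‖ ^ 2 ≤ ⟪B x, x⟫_ℝ) : IsUnit B := by
  refine ContinuousLinearMap.isUnit_of_forall_le_norm_inner_map B (c := ⟨c, hc.le⟩) hc ?_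
  intro x
  have h := (hB x).trans (le_abs_self _)
  rw [Real.norm_eq_abs]
  exact (mul_comm _ _).trans_le h

/-- The Fredholm alternative for a compact perturbation of a coercive operator. -/
theorem isUnit_coercive_add_compact {B K : H →L[ℝ] H} {c : ℝ} (hc : 0 < c)
    (hB : ∀ x, c * ‖x‖ ^ 2 ≤ ⟪B x, x⟫_ℝ) (hK : IsCompactOperator K)
    (hinj : ∀ x, B x + K x = 0 → x = 0) : IsUnit (B + K) := by
  obtain ⟨b, rfl⟩ := isUnit_of_coercive hc hB
  have hbb : ∀ x : H, (b : H →L[ℝ] H) ((↑b⁻¹ : H →L[ℝ] H) x) = x := fun x => by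
    rw [← mul_apply_eq_comp, Units.mul_inv]; rfl
  have hT : IsCompactOperator ((↑b⁻¹ : H →L[ℝ] H) * K) := hK.clm_comp (↑b⁻¹ : H →L[ℝ] H)
  -- Factor `B + K = B (1 + B⁻¹ K)`; injectivity excludes `-1` as an eigenvalue of the compact
  -- operator `B⁻¹ K`.
  have hfac : (b : H →L[ℝ] H) + K
      = (b : H →L[ℝ] H) * -(algebraMap ℝ (H →L[ℝ] H) (-1) - (↑b⁻¹ : H →L[ℝ] H) * K) := by
    rw [map_neg, map_one, neg_sub, sub_neg_eq_add, mul_add, ← mul_assoc, Units.mul_inv, one_mul,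
      mul_one, add_comm]
  rw [hfac]
  refine b.isUnit.mul (IsUnit.neg ?_)
  rw [← spectrum.mem_resolventSet_iff]
  refine (hT.hasEigenvalue_or_mem_resolventSet (by norm_num)).resolve_left ?_
  intro hev
  obtain ⟨x, hx, hx0⟩ := hev.exists_hasEigenvector
  rw [Module.End.mem_eigenspace_iff] at hx
  refine hx0 (hinj x ?_)
  have h2 : (↑b⁻¹ : H →L[ℝ] H) (K x) = (-1 : ℝ) • x := hx
  have h3 := congrArg (b : H →L[ℝ] H) h2
  rw [hbb] at h3
  rw [h3]
  simp

/-- Instability: a direction orthogonal to `φ` in which `Lp` is negative gives a growing mode. -/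
theorem exists_growing_mode {Lp Lm B Kp Km : H →L[ℝ] H}
    (hLp : ∀ x y, ⟪Lp x, y⟫_ℝ = ⟪x, Lp y⟫_ℝ)
    (hLm : ∀ x y, ⟪Lm x, y⟫_ℝ = ⟪x, Lm y⟫_ℝ) (hpos : ∀ x, 0 ≤ ⟪Lm x, x⟫_ℝ)
    {c : ℝ} (hc : 0 < c) (hB : ∀ x, c * ‖x‖ ^ 2 ≤ ⟪B x, x⟫_ℝ)
    (hKp : IsCompactOperator Kp) (hKm : IsCompactOperator Km)
    (hp : Lp = B - Kp) (hm : Lm = B - Km) {φ : H} (hφ0 : φ ≠ 0)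
    (hφ : Lm φ = 0) (hker : ∀ x, Lm x = 0 → ∃ a : ℝ, x = a • φ)
    {v : H} (hvφ : ⟪v, φ⟫_ℝ = 0) (hv : ⟪Lp v, v⟫_ℝ < 0) :
    ∃ (μ : ℝ) (f g : H), 0 < μ ∧ f ≠ 0 ∧ -Lm g = μ • f ∧ Lp f = μ • g := by
  have hφφ : 0 < ⟪φ, φ⟫_ℝ := real_inner_self_pos.2 hφ0
  set P := InnerProductSpace.rankOne ℝ φ φ with hP
  have hPapp : ∀ x, P x = ⟪φ, x⟫_ℝ • φ := fun x => by simp [hP]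
  have hPc : IsCompactOperator P := isCompactOperator_rankOne φ
  have hLmφ : ∀ x, ⟪Lm x, φ⟫_ℝ = 0 := fun x => by rw [hLm, hφ, inner_zero_right]
  have kerperp : ∀ x, Lm x = 0 → ⟪φ, x⟫_ℝ = 0 → x = 0 := by
    intro x hx hxφ
    obtain ⟨a, rfl⟩ := hker x hx
    rw [inner_smul_right] at hxφ
    rw [(mul_eq_zero.1 hxφ).resolve_right hφφ.ne', zero_smul]
  -- The range of `Lm` is all of `φ^⊥`: adding the projection-like `P` makes `Lm` invertible, and
  -- pairing with `φ` shows that the `P` term vanishes on the solution.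
  obtain ⟨h₀, rfl⟩ : ∃ h, Lm h = v := by
    have hU : IsUnit (B + (P - Km)) := by
      refine isUnit_coercive_add_compact hc hB (hPc.sub hKm) fun x hx => ?_
      have hx' : Lm x + ⟪φ, x⟫_ℝ • φ = 0 := by
        rw [← hPapp, hm]; simpa [add_sub_assoc, sub_add_eq_add_sub] using hx
      have h2 := congrArg (fun z => ⟪z, φ⟫_ℝ) hx'
      simp only [inner_add_left, hLmφ, inner_smul_left, conj_trivial, zero_add,
        inner_zero_left] at h2
      have h3 := (mul_eq_zero.1 h2).resolve_right hφφ.ne'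
      rw [h3, zero_smul, add_zero] at hx'
      exact kerperp x hx' h3
    obtain ⟨x, hx⟩ := (ContinuousLinearMap.isUnit_iff_bijective.1 hU).2 v
    have hx' : Lm x + ⟪φ, x⟫_ℝ • φ = v := by
      rw [← hPapp, hm]; simpa [add_sub_assoc, sub_add_eq_add_sub] using hx
    have h2 := congrArg (fun z => ⟪z, φ⟫_ℝ) hx'
    simp only [inner_add_left, hLmφ, inner_smul_left, conj_trivial, zero_add, hvφ] at h2
    have h3 := (mul_eq_zero.1 h2).resolve_right hφφ.ne'
    rw [h3, zero_smul, add_zero] at hx'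
    exact ⟨x, hx'⟩
  -- The infimum `l` of `Λ` is the square of the growth rate. `Λ` is nonempty by the Cauchy–Schwarz
  -- bound `‖Lm h‖² ≤ (‖Lm‖ + 1) ⟪Lm h, h⟫`, and `l > 0` because `h₀` makes the first term negative.
  set Λ : Set ℝ := {l | 0 ≤ l ∧ ∀ h, 0 ≤ ⟪Lp (Lm h), Lm h⟫_ℝ + l * ⟪Lm h, h⟫_ℝ} with hΛ
  have hbdd : BddBelow Λ := ⟨0, fun l hl => hl.1⟩
  have hne : Λ.Nonempty := by
    refine ⟨‖Lp‖ * (‖Lm‖ + 1), by positivity, fun h => ?_⟩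
    have h1 := norm_map_sq_le_of_nonneg hLm hpos h
    have h2 : -(‖Lp‖ * ‖Lm h‖ ^ 2) ≤ ⟪Lp (Lm h), Lm h⟫_ℝ := by
      have h3 := neg_le_of_abs_le (abs_real_inner_le_norm (Lp (Lm h)) (Lm h))
      have h4 := mul_le_mul_of_nonneg_right (Lp.le_opNorm (Lm h)) (norm_nonneg (Lm h))
      linarith [sq (‖Lm h‖), mul_assoc ‖Lp‖ ‖Lm h‖ ‖Lm h‖]
    have h5 := mul_le_mul_of_nonneg_left h1 (norm_nonneg Lp)
    linarith [mul_assoc ‖Lp‖ (‖Lm‖ + 1) ⟪Lm h, h⟫_ℝ]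
  have hclosed : IsClosed Λ := by
    have : Λ = Set.Ici 0 ∩ ⋂ h, {l | 0 ≤ ⟪Lp (Lm h), Lm h⟫_ℝ + l * ⟪Lm h, h⟫_ℝ} := by
      ext l; simp [hΛ]
    rw [this]
    exact isClosed_Ici.inter (isClosed_iInter fun h =>
      isClosed_le continuous_const (by fun_prop))
  set l := sInf Λ with hl
  obtain ⟨hl0, hlq⟩ : l ∈ Λ := hclosed.csInf_mem hne hbdd
  have hlpos : 0 < l := by
    refine lt_of_le_of_ne hl0 fun h0 => ?_
    have := hlq h₀
    rw [← h0] at this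
    linarith
  -- Otherwise `Lm Lp Lm + l Lm + P` is injective. It is the coercive `Lm B Lm + l B` plus a compact
  -- operator, so it is invertible. Being also nonnegative, it is coercive, and `l` could be
  -- lowered.
  obtain ⟨h, hh, hLmh⟩ : ∃ h, Lm (Lp (Lm h)) + l • Lm h = 0 ∧ Lm h ≠ 0 := by
    by_contra! hcon
    have hU : IsUnit ((Lm * B * Lm + l • B) + (P - (Lm * Kp * Lm + l • Km))) := by
      refine isUnit_coercive_add_compact (c := l * c) (by positivity) (fun x => ?_) ?_ ?_
      · have h1 := hB (Lm x)
        have h2 := mul_le_mul_of_nonneg_left (hB x) hl0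
        simp only [add_apply, mul_apply_eq_comp,
          smul_apply, inner_add_left, inner_smul_left, hLm _ x, conj_trivial]
        have h3 : 0 ≤ c * ‖Lm x‖ ^ 2 := by positivity
        linarith
      · exact hPc.sub (((hKp.clm_comp Lm).comp_clm Lm).add (hKm.smul l))
      · intro x hx
        have hx' : (Lm (Lp (Lm x)) + l • Lm x) + ⟪φ, x⟫_ℝ • φ = 0 := by
          rw [← hPapp, ← hx, hp]
          have hBx : B x = Lm x + Km x := by rw [hm]; simp
          simp only [add_apply, sub_apply, mul_apply_eq_comp, smul_apply, hBx, map_sub]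
          module
        have h2 := congrArg (fun z => ⟪z, φ⟫_ℝ) hx'
        simp only [inner_add_left, hLmφ, inner_smul_left, conj_trivial, zero_add, mul_zero,
          inner_zero_left] at h2
        have h3 := (mul_eq_zero.1 h2).resolve_right hφφ.ne'
        rw [h3, zero_smul, add_zero] at hx'
        exact kerperp x (hcon x hx') h3
    have hG : (Lm * B * Lm + l • B) + (P - (Lm * Kp * Lm + l • Km))
        = Lm * Lp * Lm + l • Lm + P := by
      ext x
      rw [hp]
      have hBx : B x = Lm x + Km x := by rw [hm]; simp
      simp only [add_apply, sub_apply, mul_apply_eq_comp, smul_apply, hBx, map_sub]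
      module
    rw [hG] at hU
    have hq : ∀ x, ⟪(Lm * Lp * Lm + l • Lm + P) x, x⟫_ℝ
        = ⟪Lp (Lm x), Lm x⟫_ℝ + l * ⟪Lm x, x⟫_ℝ + ⟪φ, x⟫_ℝ ^ 2 := by
      intro x
      simp only [add_apply, mul_apply_eq_comp,
          smul_apply, inner_add_left, inner_smul_left, hPapp, conj_trivial]
      rw [hLm (Lp (Lm x)) x, sq]
    obtain ⟨κ, hκ, hcoer⟩ := coercive_of_nonneg_of_isUnit (T := Lm * Lp * Lm + l • Lm + P)
      (fun x y => by
        simp only [add_apply, mul_apply_eq_comp,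
          smul_apply, inner_add_left, inner_add_right, inner_smul_left,
          inner_smul_right, hPapp, conj_trivial]
        rw [hLm (Lp (Lm x)), hLp, hLm x (Lp _), hLm x y, real_inner_comm x φ]
        ring)
      (fun x => by rw [hq]; nlinarith [hlq x, sq_nonneg ⟪φ, x⟫_ℝ]) hU
    set ε := min l (κ / (‖Lm‖ + 1)) with hε
    have hεpos : 0 < ε := lt_min hlpos (by positivity)
    have hmem : l - ε ∈ Λ := by
      refine ⟨sub_nonneg.2 (min_le_left _ _), fun x => ?_⟩
      -- Removing the `φ` component leaves the forms in `Λ` unchanged and kills the rank-one term in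
      -- the coercive form.
      set a := ⟪φ, x⟫_ℝ / ⟪φ, φ⟫_ℝ with ha
      set k := x - a • φ with hk
      have hLk : Lm k = Lm x := by rw [hk, map_sub, map_smul, hφ, smul_zero, sub_zero]
      have hkφ : ⟪φ, k⟫_ℝ = 0 := by
        rw [hk, inner_sub_right, inner_smul_right, ha]; field_simp; simp
      have hxk : ⟪Lm x, x⟫_ℝ = ⟪Lm k, k⟫_ℝ := by
        rw [hLk, hk, inner_sub_right, inner_smul_right, hLmφ, mul_zero, sub_zero]
      have h1 := hcoer k
      rw [hq, hkφ] at h1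
      rw [hxk, ← hLk]
      have h2 : ⟪Lm k, k⟫_ℝ ≤ (‖Lm‖ + 1) * ‖k‖ ^ 2 := by
        have h3 := real_inner_le_norm (Lm k) k
        have h4 := Lm.le_opNorm k
        nlinarith [norm_nonneg k]
      have h5 : ε * ⟪Lm k, k⟫_ℝ ≤ κ * ‖k‖ ^ 2 := by
        have h6 : ε * (‖Lm‖ + 1) ≤ κ := by
          rw [← le_div_iff₀ (by positivity)]; exact min_le_right _ _
        calc ε * ⟪Lm k, k⟫_ℝ ≤ ε * ((‖Lm‖ + 1) * ‖k‖ ^ 2) :=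
              mul_le_mul_of_nonneg_left h2 hεpos.le
          _ = (ε * (‖Lm‖ + 1)) * ‖k‖ ^ 2 := by ring
          _ ≤ κ * ‖k‖ ^ 2 := mul_le_mul_of_nonneg_right h6 (by positivity)
      nlinarith
    have := csInf_le hbdd hmem
    rw [← hl] at this
    linarith
  obtain ⟨a, ha⟩ := hker (Lp (Lm h) + l • h) (by rw [map_add, map_smul, hh])
  have hμ : 0 < √l := Real.sqrt_pos.2 hlpos
  -- The `φ` term in `g` is invisible to `Lm` and absorbs the kernel component `a • φ` of `Lp (Lm h)
  -- + l • h`.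
  refine ⟨√l, Lm h, -(√l • h) + (a / √l) • φ, hμ, hLmh, ?_, ?_⟩
  · rw [map_add, map_neg, map_smul, map_smul, hφ, smul_zero, add_zero, neg_neg]
  · rw [smul_add, smul_neg, smul_smul, smul_smul, Real.mul_self_sqrt hl0,
      mul_div_cancel₀ _ hμ.ne', ← ha]
    abel

end Abstract

end DNLS

namespace DNLS

/-! ### The sequence space: multiplication operators, translations, the Laplacian and its maximum
principle. -/

section Sequences

variable {d : ℕ}

theorem summable_sq (f : L2 d ℝ) : Summable fun n => f n ^ 2 := by
  have h := (lp.memℓp f).summable (by norm_num)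
  simpa using h

theorem norm_sq_eq_tsum (f : L2 d ℝ) : ‖f‖ ^ 2 = ∑' n, f n ^ 2 := by
  have h := lp.norm_rpow_eq_tsum (p := 2) (by norm_num) f
  simpa using h

theorem inner_eq_tsum (f g : L2 d ℝ) : inner ℝ f g = ∑' n, f n * g n := by
  rw [lp.inner_eq_tsum]
  exact tsum_congr fun n => by simp [mul_comm]

theorem summable_mul (f g : L2 d ℝ) : Summable fun n => f n * g n := by
  have h := lp.summable_inner (𝕜 := ℝ) f g
  simpa [mul_comm] using h

theorem abs_apply_le_norm (f : L2 d ℝ) (n : Lattice d) : |f n| ≤ ‖f‖ := by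
  simpa using lp.norm_apply_le_norm (by norm_num) f n

theorem memℓp_two_of_summable {f : Lattice d → ℝ} (hf : Summable fun n => f n ^ 2) :
    Memℓp f 2 :=
  memℓp_gen (by simpa using hf)

theorem memℓp_of_abs_le {f : Lattice d → ℝ} {C : ℝ} (g : L2 d ℝ)
    (h : ∀ n, |f n| ≤ C * |g n|) : Memℓp f 2 := by
  refine memℓp_two_of_summable ?_
  refine Summable.of_nonneg_of_le (fun n => sq_nonneg _) (fun n => ?_)
    ((summable_sq g).mul_left (C ^ 2))
  rw [← sq_abs, ← sq_abs (g n), ← mul_pow]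
  exact pow_le_pow_left₀ (abs_nonneg _) (h n) 2

theorem norm_le_of_abs_le {f g : L2 d ℝ} {C : ℝ} (hC : 0 ≤ C)
    (h : ∀ n, |f n| ≤ C * |g n|) : ‖f‖ ≤ C * ‖g‖ := by
  refine (pow_le_pow_iff_left₀ (norm_nonneg _) (by positivity) two_ne_zero).1 ?_
  rw [mul_pow, norm_sq_eq_tsum, norm_sq_eq_tsum, ← tsum_mul_left]
  refine (summable_sq f).tsum_le_tsum (fun n => ?_) ((summable_sq g).mul_left _)
  rw [← sq_abs, ← sq_abs (g n), ← mul_pow]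
  exact pow_le_pow_left₀ (abs_nonneg _) (h n) 2

/-- Multiplication by a bounded sequence. -/
noncomputable def mulOp (a : Lattice d → ℝ) (ha : ∃ C, ∀ n, |a n| ≤ C) : L2 d ℝ →L[ℝ] L2 d ℝ :=
  LinearMap.mkContinuousOfExistsBound
    { toFun := fun f => ⟨fun n => a n * f n, memℓp_of_abs_le (C := ha.choose) f fun n => by
        rw [abs_mul]; exact mul_le_mul_of_nonneg_right (ha.choose_spec n) (abs_nonneg _)⟩
      map_add' := fun f g => lp.ext (funext fun n => mul_add _ _ _)
      map_smul' := fun c f => lp.ext (funext fun n => mul_left_comm _ _ _) }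
    ⟨ha.choose, fun f => norm_le_of_abs_le ((abs_nonneg _).trans (ha.choose_spec 0)) fun n => by
      refine (abs_mul _ _).trans_le ?_
      exact mul_le_mul_of_nonneg_right (ha.choose_spec n) (abs_nonneg _)⟩

@[simp]
theorem mulOp_apply (a : Lattice d → ℝ) (ha : ∃ C, ∀ n, |a n| ≤ C) (f : L2 d ℝ)
    (n : Lattice d) : mulOp a ha f n = a n * f n := rfl

theorem inner_mulOp (a : Lattice d → ℝ) (ha : ∃ C, ∀ n, |a n| ≤ C) (f g : L2 d ℝ) :
    inner ℝ (mulOp a ha f) g = inner ℝ f (mulOp a ha g) := by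
  rw [inner_eq_tsum, inner_eq_tsum]
  exact tsum_congr fun n => by simp only [mulOp_apply]; ring

theorem isCompactOperator_sum_rankOne {H ι : Type*} [NormedAddCommGroup H]
    [InnerProductSpace ℝ H] (s : Finset ι) (a : ι → ℝ) (e : ι → H) :
    IsCompactOperator (∑ i ∈ s, a i • InnerProductSpace.rankOne ℝ (e i) (e i) : H →L[ℝ] H) :=
  (compactOperator (RingHom.id ℝ) H H).sum_mem fun i _ =>
    (compactOperator (RingHom.id ℝ) H H).smul_mem (a i)
      (show InnerProductSpace.rankOne ℝ (e i) (e i) ∈ compactOperator (RingHom.id ℝ) H H from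
        isCompactOperator_rankOne (e i))

/-- Multiplication by a sequence that tends to zero at infinity is compact. -/
theorem isCompactOperator_mulOp {a : Lattice d → ℝ} (ha : ∃ C, ∀ n, |a n| ≤ C)
    (h0 : Tendsto a cofinite (𝓝 0)) : IsCompactOperator (mulOp a ha) := by
  -- Compact operators are norm closed, and restricting `a` to the finitely many sites where `|a n|
  -- ≥ ε / 2` gives a finite-rank approximation.
  refine isClosed_setOfPred_isCompactOperator.closure_subset (Metric.mem_closure_iff.2 ?_)
  intro ε hε
  have hfin : {n | ¬ |a n| < ε / 2}.Finite := by
    have h1 := (tendsto_order.1 h0.abs).2 (ε / 2) (by simpa using hε)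
    exact h1
  set s := hfin.toFinset with hs
  obtain ⟨F, hF, hval⟩ : ∃ F : L2 d ℝ →L[ℝ] L2 d ℝ, IsCompactOperator F ∧
      ∀ (f : L2 d ℝ) (n : Lattice d), F f n = if n ∈ s then a n * f n else 0 := by
    refine ⟨∑ n ∈ s, a n • InnerProductSpace.rankOne ℝ (lp.single 2 n (1 : ℝ))
      (lp.single 2 n (1 : ℝ)), ?_, fun f n => ?_⟩
    · exact isCompactOperator_sum_rankOne s a fun n => lp.single 2 n (1 : ℝ)
    · simp only [sum_apply, smul_apply, InnerProductSpace.rankOne_apply,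
        lp.coeFn_sum, Finset.sum_apply, lp.coeFn_smul, Pi.smul_apply, lp.single_apply,
        lp.inner_single_left, smul_eq_mul]
      rw [← Finset.sum_ite_eq s n fun m => a m * f m]
      refine Finset.sum_congr rfl fun m _ => ?_
      by_cases h : n = m
      · subst h; simp
      · simp [h]
  refine ⟨F, hF, ?_⟩
  rw [dist_eq_norm]
  refine lt_of_le_of_lt (ContinuousLinearMap.opNorm_le_bound _ (half_pos hε).le fun f => ?_)
    (half_lt_self hε)
  refine norm_le_of_abs_le (half_pos hε).le fun n => ?_
  rw [sub_apply, lp.coeFn_sub, Pi.sub_apply, hval, mulOp_apply]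
  by_cases hn : n ∈ s
  · simp only [hn, if_true, sub_self, abs_zero]
    positivity
  · simp only [hn, if_false, sub_zero, abs_mul]
    have : |a n| < ε / 2 := by simpa [hs] using hn
    exact mul_le_mul_of_nonneg_right this.le (abs_nonneg _)

/-- Translation by a lattice vector. -/
noncomputable def shift (k : Lattice d) : L2 d ℝ →L[ℝ] L2 d ℝ :=
  LinearMap.mkContinuous
    { toFun := fun f => ⟨fun n => f (n + k), memℓp_two_of_summable
        ((summable_sq f).comp_injective (add_left_injective k))⟩
      map_add' := fun _ _ => rfl
      map_smul' := fun _ _ => rfl }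
    1 fun f => by
      refine (pow_le_pow_iff_left₀ (norm_nonneg _) (by positivity) two_ne_zero).1 (le_of_eq ?_)
      rw [one_mul, norm_sq_eq_tsum, norm_sq_eq_tsum]
      exact (Equiv.addRight k).tsum_eq fun n => f n ^ 2

@[simp]
theorem shift_apply (k : Lattice d) (f : L2 d ℝ) (n : Lattice d) : shift k f n = f (n + k) := rfl

theorem inner_shift (k : Lattice d) (f g : L2 d ℝ) :
    inner ℝ (shift k f) g = inner ℝ f (shift (-k) g) := by
  rw [inner_eq_tsum, inner_eq_tsum,
    ← (Equiv.addRight k).tsum_eq fun n => f n * shift (-k) g n]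
  exact tsum_congr fun n => by simp

theorem norm_shift (k : Lattice d) (f : L2 d ℝ) : ‖shift k f‖ = ‖f‖ := by
  refine (sq_eq_sq₀ (norm_nonneg _) (norm_nonneg _)).1 ?_
  rw [norm_sq_eq_tsum, norm_sq_eq_tsum]
  exact (Equiv.addRight k).tsum_eq fun n => f n ^ 2

/-- The nonnegative operator `-Δ`. -/
noncomputable def negLaplacian (d : ℕ) : L2 d ℝ →L[ℝ] L2 d ℝ :=
  ∑ i : Fin d, ((2 : ℝ) • ContinuousLinearMap.id ℝ (L2 d ℝ)
    - (shift (basisVec i) + shift (-basisVec i)))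

theorem negLaplacian_apply (f : L2 d ℝ) (n : Lattice d) :
    negLaplacian d f n = -discLaplacian (fun m => f m) n := by
  simp only [negLaplacian, sum_apply, lp.coeFn_sum, Finset.sum_apply,
    sub_apply, add_apply, smul_apply, lp.coeFn_sub, lp.coeFn_add, lp.coeFn_smul, Pi.sub_apply,
    Pi.add_apply, Pi.smul_apply, shift_apply, ContinuousLinearMap.id_apply, smul_eq_mul]
  simp only [discLaplacian, smul_eq_mul, Finset.sum_sub_distrib, Finset.sum_const, Finset.card_univ, Fintype.card_fin,
    nsmul_eq_mul, neg_sub, ← sub_eq_add_neg]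
  ring

theorem inner_negLaplacian (f g : L2 d ℝ) :
    inner ℝ (negLaplacian d f) g = inner ℝ f (negLaplacian d g) := by
  simp only [negLaplacian, sum_apply, sub_apply, add_apply, smul_apply,
    ContinuousLinearMap.id_apply, sum_inner, inner_sum, inner_sub_left, inner_sub_right,
    inner_add_left, inner_add_right, inner_shift, inner_smul_left, inner_smul_right, neg_neg,
    conj_trivial]
  exact Finset.sum_congr rfl fun i _ => by ring

/-- Summation by parts: for each direction, translation invariance gives `‖τf - f‖² = 2‖f‖² - 2⟨τf,
f⟩`. -/
theorem tsum_sq_diff_eq (f : L2 d ℝ) :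
    (∑' n : Lattice d, ∑ i : Fin d, |f (n + basisVec i) - f n| ^ 2)
      = inner ℝ (negLaplacian d f) f := by
  have h1 : ∀ i : Fin d, Summable fun n => |f (n + basisVec i) - f n| ^ 2 := fun i => by
    simpa using summable_sq (shift (basisVec i) f - f)
  rw [Summable.tsum_finsetSum fun i _ => h1 i]
  simp only [negLaplacian, sum_apply, sum_inner]
  refine Finset.sum_congr rfl fun i _ => ?_
  have h2 : ∑' n, |f (n + basisVec i) - f n| ^ 2 = ‖shift (basisVec i) f - f‖ ^ 2 := by
    rw [norm_sq_eq_tsum]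
    exact tsum_congr fun n => by simp
  rw [h2, norm_sub_sq_real, norm_shift]
  simp only [sub_apply, add_apply, smul_apply, ContinuousLinearMap.id_apply, inner_sub_left,
    inner_add_left, inner_smul_left, inner_shift (-basisVec i), neg_neg, conj_trivial,
    real_inner_self_eq_norm_sq, real_inner_comm (shift (basisVec i) f) f]
  ring

theorem energy_eq (ω : ℝ) (f : L2 d ℝ) :
    energy ω f = inner ℝ (negLaplacian d f) f + ω * ‖f‖ ^ 2 := by
  rw [energy, tsum_sq_diff_eq, norm_sq_eq_tsum]
  simp only [sq_abs]

theorem inner_negLaplacian_self_nonneg (f : L2 d ℝ) : 0 ≤ inner ℝ (negLaplacian d f) f := by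
  rw [← tsum_sq_diff_eq]
  positivity

/-- The pointwise absolute value. -/
noncomputable def absSeq (f : L2 d ℝ) : L2 d ℝ :=
  ⟨fun n => |f n|, memℓp_of_abs_le (C := 1) f fun n => by simp⟩

@[simp]
theorem absSeq_apply (f : L2 d ℝ) (n : Lattice d) : absSeq f n = |f n| := rfl

/-- Each bond term decreases by the reverse triangle inequality. This drives the Perron–Frobenius
argument for `L_-`. -/
theorem inner_negLaplacian_absSeq_le (f : L2 d ℝ) :
    inner ℝ (negLaplacian d (absSeq f)) (absSeq f) ≤ inner ℝ (negLaplacian d f) f := by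
  rw [← tsum_sq_diff_eq, ← tsum_sq_diff_eq]
  have hs : ∀ g : L2 d ℝ, Summable fun n => ∑ i : Fin d, |g (n + basisVec i) - g n| ^ 2 :=
    fun g => summable_sum fun i _ => by simpa using summable_sq (shift (basisVec i) g - g)
  refine (hs _).tsum_le_tsum (fun n => Finset.sum_le_sum fun i _ => ?_) (hs _)
  exact pow_le_pow_left₀ (abs_nonneg _) (abs_abs_sub_abs_le _ _) 2

/-- A nonnegative sequence with `Δ f = 0` wherever `f = 0` vanishes identically or nowhere. -/
theorem eq_zero_of_apply_eq_zero {f : Lattice d → ℝ} (hf : ∀ n, 0 ≤ f n)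
    (hΔ : ∀ n, f n = 0 → discLaplacian f n = 0) {n₀ : Lattice d} (h0 : f n₀ = 0)
    (n : Lattice d) : f n = 0 := by
  -- At a zero of `f` the Laplacian is the sum of the neighbouring values, all nonnegative; so zeros
  -- spread to every neighbour, then along lines, then coordinate by coordinate.
  have step : ∀ n, f n = 0 → ∀ i : Fin d, f (n + basisVec i) = 0 ∧ f (n - basisVec i) = 0 := by
    intro n hn i
    have h := hΔ n hn
    rw [discLaplacian, hn, smul_zero, sub_zero,
      Finset.sum_eq_zero_iff_of_nonneg fun i _ => add_nonneg (hf _) (hf _)] at h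
    have := h i (Finset.mem_univ i)
    exact (add_eq_zero_iff_of_nonneg (hf _) (hf _)).1 this
  have line : ∀ (i : Fin d) (k : ℤ) (n : Lattice d), f n = 0 → f (n + Pi.single i k) = 0 := by
    intro i k n hn
    induction k using Int.induction_on with
    | zero => simpa using hn
    | succ k ih =>
      have := (step _ ih i).1
      rwa [add_assoc, basisVec, ← Pi.single_add] at this
    | pred k ih =>
      have := (step _ ih i).2
      rwa [add_sub_assoc, basisVec, ← Pi.single_sub] at this
  have main : ∀ (s : Finset (Fin d)) (m : Lattice d), f (n₀ + ∑ i ∈ s, Pi.single i (m i)) = 0 := by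
    intro s m
    induction s using Finset.induction_on with
    | empty => simpa using h0
    | insert i s hi ih =>
      rw [Finset.sum_insert hi, ← add_assoc, add_right_comm]
      exact line i _ _ ih
  have := main Finset.univ (n - n₀)
  rwa [Finset.univ_sum_single, add_sub_cancel] at this

end Sequences

end DNLS

namespace DNLS

/-! ### One-variable calculus for the power nonlinearity and for constrained minima. -/

section RealVariable

/-- At `0` the slope is `|y|^s → 0`, so the formula holds there for every `s > 0`, however small. -/
theorem hasDerivAt_abs_rpow_mul_self {s : ℝ} (hs : 0 < s) (x : ℝ) :
    HasDerivAt (fun x : ℝ => |x| ^ s * x) ((s + 1) * |x| ^ s) x := by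
  rcases eq_or_ne x 0 with rfl | hx
  · have hc : ContinuousAt (fun x : ℝ => |x| ^ s) 0 :=
      (continuous_abs.rpow_const fun _ => Or.inr hs.le).continuousAt
    have h : HasDerivAt (fun x : ℝ => |x| ^ s * x) 0 0 := hasDerivAt_iff_tendsto_slope.2 (by
      have h0 : Tendsto (fun x : ℝ => |x| ^ s) (𝓝[≠] 0) (𝓝 0) := by
        have := hc.tendsto.mono_left (nhdsWithin_le_nhds (s := {0}ᶜ))
        simpa [Real.zero_rpow hs.ne'] using this
      refine h0.congr' ?_
      filter_upwards [self_mem_nhdsWithin] with y hy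
      have hy' : y ≠ 0 := hy
      simp [slope_def_field, hy'])
    simpa [Real.zero_rpow hs.ne'] using h
  · have h1 : HasDerivAt (fun x : ℝ => |x|) (SignType.sign x : ℝ) x := hasDerivAt_abs hx
    have h2 := (h1.rpow_const (p := s) (Or.inl (abs_ne_zero.2 hx))).mul (hasDerivAt_id x)
    refine h2.congr_deriv ?_
    have h3 : (SignType.sign x : ℝ) * x = |x| := sign_mul_self x
    have h4 : |x| ^ (s - 1) * |x| = |x| ^ s := by
      rw [← Real.rpow_add_one (abs_ne_zero.2 hx), sub_add_cancel]
    simp only [id_eq, mul_one]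
    calc _ = s * (|x| ^ (s - 1) * ((SignType.sign x : ℝ) * x)) + |x| ^ s := by ring
      _ = _ := by rw [h3, h4]; ring

theorem uniform_abs_rpow {s : ℝ} (hs : 0 < s) (R : ℝ) {ε : ℝ} (hε : 0 < ε) :
    ∃ δ > 0, ∀ x y : ℝ, |x| ≤ R → |y| ≤ R → |x - y| < δ → |(|x| ^ s) - |y| ^ s| < ε := by
  have hc : ContinuousOn (fun x : ℝ => |x| ^ s) (Set.Icc (-R) R) :=
    (continuous_abs.rpow_const fun _ => Or.inr hs.le).continuousOn
  obtain ⟨δ, hδ, h⟩ := Metric.uniformContinuousOn_iff.1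
    (isCompact_Icc.uniformContinuousOn_of_continuous hc) ε hε
  exact ⟨δ, hδ, fun x y hx hy hxy => h x (abs_le.1 hx) y (abs_le.1 hy) hxy⟩

/-- Mean value inequality with the uniform continuity of `|z|^s` on bounded sets. A quadratic
remainder is not available for small `s`; what matters is that `δ` is the same at all lattice sites.
-/
theorem abs_rpow_mul_self_remainder {s : ℝ} (hs : 0 < s) (R : ℝ) {ε : ℝ} (hε : 0 < ε) :
    ∃ δ > 0, ∀ x y : ℝ, |x| ≤ R → |y| ≤ R → |y - x| < δ →
      |(|y| ^ s * y) - |x| ^ s * x - (s + 1) * |x| ^ s * (y - x)| ≤ ε * |y - x| := by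
  obtain ⟨δ, hδ, h⟩ := uniform_abs_rpow hs R (div_pos hε (by positivity : 0 < s + 1))
  refine ⟨δ, hδ, fun x y hx hy hxy => ?_⟩
  have hseg : ∀ z ∈ Set.uIcc x y, |z| ≤ R ∧ |z - x| < δ := by
    intro z hz
    refine ⟨abs_le.2 ?_, (Set.abs_sub_left_of_mem_uIcc hz).trans_lt hxy⟩
    have hR : Set.uIcc x y ⊆ Set.Icc (-R) R :=
      Set.uIcc_subset_Icc (abs_le.1 hx) (abs_le.1 hy)
    exact hR hz
  have hmv := (convex_uIcc x y).norm_image_sub_le_of_norm_hasDerivWithin_le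
    (f := fun z : ℝ => |z| ^ s * z - (s + 1) * |x| ^ s * z)
    (f' := fun z => (s + 1) * |z| ^ s - (s + 1) * |x| ^ s) (C := ε)
    (fun z _ => ((hasDerivAt_abs_rpow_mul_self hs z).sub
      (by simpa using (hasDerivAt_id z).const_mul ((s + 1) * |x| ^ s))).hasDerivWithinAt)
    (fun z hz => by
      obtain ⟨h1, h2⟩ := hseg z hz
      have h3 := h z x h1 hx h2
      rw [lt_div_iff₀ (by positivity)] at h3
      rw [← mul_sub, Real.norm_eq_abs, abs_mul, abs_of_pos (by positivity : 0 < s + 1), mul_comm]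
      exact h3.le)
    Set.left_mem_uIcc Set.right_mem_uIcc
  rw [Real.norm_eq_abs, Real.norm_eq_abs] at hmv
  convert hmv using 2
  ring

/-- First and second order conditions at the minimum `t = 0` of
`j + 2 b t + e t ^ 2 - j N(t) ^ q`. -/
theorem variation_conditions {N N' : ℝ → ℝ} {N'' b e j q : ℝ}
    (hN : ∀ t, HasDerivAt N (N' t) t) (hN' : HasDerivAt N' N'' 0) (hN0 : N 0 = 1)
    (h : ∀ t, j * N t ^ q ≤ j + 2 * t * b + t ^ 2 * e) :
    2 * b = j * (q * N' 0) ∧ 0 ≤ 2 * e - j * (q * (q - 1) * N' 0 ^ 2 + q * N'') := by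
  set F : ℝ → ℝ := fun t => j + 2 * t * b + t ^ 2 * e - j * N t ^ q with hF
  set F' : ℝ → ℝ := fun t => 2 * b + 2 * t * e - j * (N' t * q * N t ^ (q - 1)) with hF'
  have hpos : ∀ᶠ t in 𝓝 0, 0 < N t := by
    have := (hN 0).continuousAt.tendsto
    rw [hN0] at this
    exact (tendsto_order.1 this).1 0 one_pos
  have hd : ∀ᶠ t in 𝓝 0, HasDerivAt F (F' t) t := by
    filter_upwards [hpos] with t ht
    have h1 := (hN t).rpow_const (p := q) (Or.inl ht.ne')
    have h2 : HasDerivAt (fun t : ℝ => j + 2 * t * b + t ^ 2 * e) (2 * b + 2 * t * e) t := by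
      have := ((((hasDerivAt_id t).const_mul 2).mul_const b).const_add j).add
        ((hasDerivAt_pow 2 t).mul_const e)
      exact this.congr_deriv (by simp)
    exact h2.sub (h1.const_mul j)
  have hmin : IsLocalMin F 0 := Eventually.of_forall fun t => by
    simp only [hF, hN0, Real.one_rpow]
    have := h t
    linarith
  have hF'0 : F' 0 = 0 := hmin.hasDerivAt_eq_zero hd.self_of_nhds
  have hdd : HasDerivAt F' (2 * e - j * (q * (q - 1) * N' 0 ^ 2 + q * N'')) 0 := by
    have h1 := (hN 0).rpow_const (p := q - 1) (Or.inl (by rw [hN0]; exact one_ne_zero))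
    have h2 := ((hN'.mul_const q).mul h1).const_mul j
    have h3 : HasDerivAt (fun t : ℝ => 2 * b + 2 * t * e) (2 * e) 0 := by
      have := (((hasDerivAt_id (0 : ℝ)).const_mul 2).mul_const e).const_add (2 * b)
      simpa using this
    refine (h3.sub h2).congr_deriv ?_
    simp only [hN0, Real.one_rpow]
    ring
  have hder : deriv F =ᶠ[𝓝 0] F' := hd.mono fun t ht => ht.deriv
  constructor
  · simp only [hF', hN0, Real.one_rpow] at hF'0
    linarith
  -- A negative second derivative would make `0` a local maximum as well as a minimum, so `F` would
  -- be locally constant with second derivative zero.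
  · by_contra! hneg
    have hdd' : deriv (deriv F) 0 = 2 * e - j * (q * (q - 1) * N' 0 ^ 2 + q * N'') := by
      rw [hder.deriv_eq, hdd.deriv]
    have hmax : IsLocalMax F 0 := isLocalMax_of_deriv_deriv_neg (by rw [hdd']; exact hneg)
      (by rw [hder.self_of_nhds, hF'0]) hd.self_of_nhds.continuousAt
    have hconst : F =ᶠ[𝓝 0] fun _ => F 0 := by
      filter_upwards [hmin, hmax] with t h1 h2
      exact le_antisymm h2 h1
    have hz : deriv (deriv F) 0 = 0 := by
      rw [hconst.deriv.deriv_eq]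
      simp
    rw [hdd'] at hz
    linarith

end RealVariable

/-! ### The constraint functional and its homogeneity. -/

section Variational

variable {d : ℕ} {σ ω : ℝ}

theorem abs_rpow_le_norm_rpow (hσ : 0 < σ) (f : L2 d ℝ) (n : Lattice d) :
    |f n| ^ (2 * σ) ≤ ‖f‖ ^ (2 * σ) :=
  Real.rpow_le_rpow (abs_nonneg _) (abs_apply_le_norm f n) (by positivity)

theorem bounded_abs_rpow (hσ : 0 < σ) (f : L2 d ℝ) :
    ∃ C, ∀ n : Lattice d, |(|f n| ^ (2 * σ))| ≤ C :=
  ⟨‖f‖ ^ (2 * σ), fun n => by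
    rw [abs_of_nonneg (by positivity)]; exact abs_rpow_le_norm_rpow hσ f n⟩

/-- Multiplication by `|u| ^ (2σ)`. -/
noncomputable def potential (hσ : 0 < σ) (u : L2 d ℝ) : L2 d ℝ →L[ℝ] L2 d ℝ :=
  mulOp (fun n => |u n| ^ (2 * σ)) (bounded_abs_rpow hσ u)

@[simp]
theorem potential_apply (hσ : 0 < σ) (u f : L2 d ℝ) (n : Lattice d) :
    potential hσ u f n = |u n| ^ (2 * σ) * f n := rfl

theorem inner_potential (hσ : 0 < σ) (u f g : L2 d ℝ) :
    inner ℝ (potential hσ u f) g = inner ℝ f (potential hσ u g) := inner_mulOp _ _ _ _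

theorem abs_rpow_add_two (hσ : 0 < σ) (x : ℝ) :
    |x| ^ (2 * σ + 2) = |x| ^ (2 * σ) * x * x := by
  rcases eq_or_ne x 0 with rfl | hx
  · simp [Real.zero_rpow (by positivity : 2 * σ + 2 ≠ 0)]
  · rw [Real.rpow_add (abs_pos.2 hx), Real.rpow_two, sq_abs]; ring

theorem hasSum_abs_rpow (hσ : 0 < σ) (w : L2 d ℝ) :
    HasSum (fun n => |w n| ^ (2 * σ + 2)) (inner ℝ (potential hσ w w) w) := by
  have h := (summable_mul (potential hσ w w) w).hasSum
  rw [← inner_eq_tsum] at h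
  simpa only [potential_apply, ← abs_rpow_add_two hσ] using h

theorem constraint_iff (hσ : 0 < σ) (w : L2 d ℝ) :
    Constraint σ w ↔ inner ℝ (potential hσ w w) w = 1 := by
  rw [Constraint, (hasSum_abs_rpow hσ w).tsum_eq]

theorem inner_potential_smul (hσ : 0 < σ) {t : ℝ} (ht : 0 ≤ t) (w : L2 d ℝ) :
    inner ℝ (potential hσ (t • w) (t • w)) (t • w)
      = t ^ (2 * σ + 2) * inner ℝ (potential hσ w w) w := by
  rw [← (hasSum_abs_rpow hσ (t • w)).tsum_eq, ← (hasSum_abs_rpow hσ w).tsum_eq, ← tsum_mul_left]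
  refine tsum_congr fun n => ?_
  rw [lp.coeFn_smul, Pi.smul_apply, smul_eq_mul, abs_mul, abs_of_nonneg ht,
    Real.mul_rpow ht (abs_nonneg _)]

theorem energy_smul (ω t : ℝ) (w : L2 d ℝ) : energy ω (t • w) = t ^ 2 * energy ω w := by
  simp only [energy_eq, map_smul, inner_smul_left, inner_smul_right, norm_smul, conj_trivial,
    mul_pow, Real.norm_eq_abs, sq_abs]
  ring

theorem inner_potential_self_pos (hσ : 0 < σ) {w : L2 d ℝ} (hw : w ≠ 0) :
    0 < inner ℝ (potential hσ w w) w := by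
  have h := hasSum_abs_rpow hσ w
  obtain ⟨n, hn⟩ : ∃ n, w n ≠ 0 := by
    by_contra! hcon
    exact hw (lp.ext (funext hcon))
  have h1 := le_hasSum h n fun m _ => by positivity
  have h2 : 0 < |w n| ^ (2 * σ + 2) := Real.rpow_pos_of_pos (abs_pos.2 hn) _
  linarith

theorem exists_constraint_smul (hσ : 0 < σ) {w : L2 d ℝ} (hw : w ≠ 0) :
    ∃ t > 0, Constraint σ (t • w) ∧ t ^ 2 * inner ℝ (potential hσ w w) w ^ (2 / (2 * σ + 2)) = 1 := by
  have hN := inner_potential_self_pos hσ hw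
  have hp : 0 < 2 * σ + 2 := by positivity
  set N := inner ℝ (potential hσ w w) w with hNdef
  refine ⟨N ^ (-(1 / (2 * σ + 2))), Real.rpow_pos_of_pos hN _, ?_, ?_⟩
  · rw [constraint_iff hσ, inner_potential_smul hσ (Real.rpow_nonneg hN.le _), ← hNdef,
      ← Real.rpow_mul hN.le, neg_mul, one_div_mul_cancel hp.ne', Real.rpow_neg_one,
      inv_mul_cancel₀ hN.ne']
  · rw [← Real.rpow_natCast, ← Real.rpow_mul hN.le, ← Real.rpow_add hN]
    have : -(1 / (2 * σ + 2)) * ((2 : ℕ) : ℝ) + 2 / (2 * σ + 2) = 0 := by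
      push_cast; ring
    rw [this, Real.rpow_zero]

/-- Both sides are homogeneous of degree two, so normalizing `w` removes the constraint; variations
of `u` need not stay on the constraint set. -/
theorem IsMinimizer.le_energy (hσ : 0 < σ) {u : L2 d ℝ} (hu : IsMinimizer σ ω u) (w : L2 d ℝ) :
    energy ω u * inner ℝ (potential hσ w w) w ^ (2 / (2 * σ + 2)) ≤ energy ω w := by
  rcases eq_or_ne w 0 with rfl | hw
  · simp [energy_eq, Real.zero_rpow (by positivity : 2 / (2 * σ + 2) ≠ 0)]
  · obtain ⟨t, ht, hc, htN⟩ := exists_constraint_smul hσ hw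
    have h := hu.2 _ hc
    rw [energy_smul] at h
    have ht2 : 0 < t ^ 2 := by positivity
    refine le_of_mul_le_mul_left ?_ ht2
    calc _ = energy ω u * (t ^ 2 * inner ℝ (potential hσ w w) w ^ (2 / (2 * σ + 2))) := by ring
      _ ≤ _ := by rw [htN, mul_one]; exact h

end Variational

end DNLS

namespace DNLS

/-! ### First and second variation at a minimizer, and the rescaled wave equation. -/

section Minimizer

variable {d : ℕ} {σ ω : ℝ}

/-- The finitely supported truncation of a sequence. -/
noncomputable def truncate (s : Finset (Lattice d)) (v : L2 d ℝ) : L2 d ℝ :=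
  ∑ n ∈ s, lp.single 2 n (v n)

theorem truncate_apply (s : Finset (Lattice d)) (v : L2 d ℝ) (n : Lattice d) :
    truncate s v n = if n ∈ s then v n else 0 := by
  simp only [truncate, lp.coeFn_sum, Finset.sum_apply, lp.single_apply]
  exact Finset.sum_pi_single n v s

theorem tendsto_truncate (v : L2 d ℝ) :
    Tendsto (fun s : Finset (Lattice d) => truncate s v) atTop (𝓝 v) :=
  lp.hasSum_single (by norm_num) v

/-- Expansion of the constraint functional along a finitely supported perturbation. -/
theorem inner_potential_add_truncate (hσ : 0 < σ) (u v : L2 d ℝ) (s : Finset (Lattice d)) (t : ℝ) :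
    inner ℝ (potential hσ (u + t • truncate s v) (u + t • truncate s v)) (u + t • truncate s v)
      = inner ℝ (potential hσ u u) u
        + ∑ n ∈ s, (|u n + t * v n| ^ (2 * σ + 2) - |u n| ^ (2 * σ + 2)) := by
  have h1 := hasSum_abs_rpow hσ (u + t • truncate s v)
  have h2 := hasSum_abs_rpow hσ u
  have h3 : HasSum (fun n => |(u + t • truncate s v) n| ^ (2 * σ + 2) - |u n| ^ (2 * σ + 2))
      (∑ n ∈ s, (|u n + t * v n| ^ (2 * σ + 2) - |u n| ^ (2 * σ + 2))) := by
    have h4 : ∀ n, (u + t • truncate s v) n = u n + t * (if n ∈ s then v n else 0) := fun n => by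
      rw [← truncate_apply]; rfl
    have h5 := hasSum_sum_of_ne_finset_zero (s := s) (L := SummationFilter.unconditional _)
      (f := fun n => |(u + t • truncate s v) n| ^ (2 * σ + 2) - |u n| ^ (2 * σ + 2))
      fun n hn => by simp only [h4, hn, if_false, mul_zero, add_zero, sub_self]
    convert h5 using 1
    exact Finset.sum_congr rfl fun n hn => by simp only [h4, hn, if_true]
  linarith [(h1.sub h2).unique h3]

theorem inner_potential_truncate (hσ : 0 < σ) (u f v : L2 d ℝ) (s : Finset (Lattice d)) :
    inner ℝ (potential hσ u f) (truncate s v) = ∑ n ∈ s, |u n| ^ (2 * σ) * f n * v n := by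
  rw [inner_eq_tsum, tsum_eq_sum (s := s) fun n hn => by simp [truncate_apply, hn]]
  exact Finset.sum_congr rfl fun n hn => by simp [truncate_apply, hn]

/-- Along a finitely supported direction the constraint functional changes by a finite sum, so it
can be differentiated term by term, with no interchange of limits. Density then extends both
conditions to all of `ℓ²`. -/
theorem IsMinimizer.variation_truncate (hσ : 0 < σ) {u : L2 d ℝ} (hu : IsMinimizer σ ω u)
    (v : L2 d ℝ) (s : Finset (Lattice d)) :
    inner ℝ (negLaplacian d u + ω • u) (truncate s v)
        = energy ω u * inner ℝ (potential hσ u u) (truncate s v) ∧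
      0 ≤ energy ω (truncate s v)
        - (2 * σ + 1) * energy ω u * inner ℝ (potential hσ u (truncate s v)) (truncate s v)
        + 2 * σ * energy ω u * inner ℝ (potential hσ u u) (truncate s v) ^ 2 := by
  have hp : 0 < 2 * σ + 2 := by positivity
  set p := 2 * σ + 2 with hpdef
  have hcon : inner ℝ (potential hσ u u) u = 1 := (constraint_iff hσ u).1 hu.1
  have hlin : ∀ n t, HasDerivAt (fun t : ℝ => u n + t * v n) (v n) t := fun n t => by
    simpa using ((hasDerivAt_id t).mul_const (v n)).const_add (u n)
  have hN : ∀ t : ℝ, HasDerivAt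
      (fun t : ℝ => 1 + ∑ n ∈ s, (|u n + t * v n| ^ p - |u n| ^ p))
      (∑ n ∈ s, p * (|u n + t * v n| ^ (2 * σ) * (u n + t * v n)) * v n) t := fun t => by
    refine HasDerivAt.const_add _ (HasDerivAt.fun_sum fun n _ => HasDerivAt.sub_const _ ?_)
    have := (hasDerivAt_abs_rpow (u n + t * v n) (p := p) (by linarith)).comp t (hlin n t)
    refine this.congr_deriv ?_
    rw [hpdef, add_sub_cancel_right]
    ring
  have hN' : HasDerivAt (fun t : ℝ => ∑ n ∈ s, p * (|u n + t * v n| ^ (2 * σ) * (u n + t * v n))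
      * v n) (∑ n ∈ s, p * ((2 * σ + 1) * |u n| ^ (2 * σ) * v n) * v n) 0 := by
    refine HasDerivAt.fun_sum fun n _ => HasDerivAt.mul_const (HasDerivAt.const_mul _ ?_) _
    have := (hasDerivAt_abs_rpow_mul_self (s := 2 * σ) (by positivity) (u n + 0 * v n)).comp 0
      (hlin n 0)
    refine this.congr_deriv ?_
    rw [zero_mul, add_zero]
  -- The exponent `q = 2 / p` is the one in `le_energy`; it cancels the factor `p` from
  -- differentiating `|x|^p`.
  obtain ⟨h1, h2⟩ := variation_conditions (b := inner ℝ (negLaplacian d u + ω • u) (truncate s v))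
    (e := energy ω (truncate s v)) (j := energy ω u) (q := 2 / p) hN hN' (by simp) fun t => by
      have h := hu.le_energy hσ (u + t • truncate s v)
      rw [inner_potential_add_truncate, hcon] at h
      refine h.trans (le_of_eq ?_)
      simp only [energy_eq, map_add, map_smul, inner_add_left, inner_add_right, inner_smul_left,
        inner_smul_right, conj_trivial, norm_add_sq_real, norm_smul, mul_pow, Real.norm_eq_abs,
        sq_abs, inner_negLaplacian (truncate s v) u, real_inner_comm (negLaplacian d u)]
      ring
  have e1 : ∑ n ∈ s, p * (|u n + 0 * v n| ^ (2 * σ) * (u n + 0 * v n)) * v n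
      = p * inner ℝ (potential hσ u u) (truncate s v) := by
    rw [inner_potential_truncate, Finset.mul_sum]
    exact Finset.sum_congr rfl fun n _ => by rw [zero_mul, add_zero]; ring
  have e2 : ∑ n ∈ s, p * ((2 * σ + 1) * |u n| ^ (2 * σ) * v n) * v n
      = p * (2 * σ + 1) * inner ℝ (potential hσ u (truncate s v)) (truncate s v) := by
    rw [inner_potential_truncate, Finset.mul_sum]
    refine Finset.sum_congr rfl fun n hn => ?_
    rw [truncate_apply, if_pos hn]; ring
  rw [e1] at h1 h2
  rw [e2] at h2
  have hq : 2 / p * p = 2 := div_mul_cancel₀ _ hp.ne'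
  constructor
  · linear_combination h1 / 2 + energy ω u * inner ℝ (potential hσ u u) (truncate s v) / 2 * hq
  · set X := inner ℝ (potential hσ u u) (truncate s v)
    set Y := inner ℝ (potential hσ u (truncate s v)) (truncate s v)
    have h3 : 2 / p * (2 / p - 1) * (p * X) ^ 2 + 2 / p * (p * (2 * σ + 1) * Y)
        = 2 * (-(2 * σ) * X ^ 2 + (2 * σ + 1) * Y) := by
      have : 2 / p * (2 / p - 1) * (p * X) ^ 2 = (2 / p * p) * ((2 / p * p) - p) * X ^ 2 := by ring
      rw [this, hq, hpdef]
      linear_combination (2 * σ + 1) * Y * hq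
    rw [h3] at h2
    linarith

theorem IsMinimizer.euler_lagrange (hσ : 0 < σ) {u : L2 d ℝ} (hu : IsMinimizer σ ω u) :
    negLaplacian d u + ω • u = energy ω u • potential hσ u u := by
  rw [← sub_eq_zero, ← inner_self_eq_zero (𝕜 := ℝ)]
  have hcl : ∀ v, inner ℝ (negLaplacian d u + ω • u - energy ω u • potential hσ u u) v = 0 := by
    intro v
    have hcont : Tendsto (fun s => inner ℝ (negLaplacian d u + ω • u
        - energy ω u • potential hσ u u) (truncate s v)) atTop
        (𝓝 (inner ℝ (negLaplacian d u + ω • u - energy ω u • potential hσ u u) v)) :=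
      tendsto_const_nhds.inner (tendsto_truncate v)
    refine tendsto_nhds_unique hcont ?_
    refine tendsto_const_nhds.congr fun s => ?_
    rw [inner_sub_left, inner_smul_left, (hu.variation_truncate hσ v s).1]
    simp
  exact hcl _

theorem IsMinimizer.second_variation (hσ : 0 < σ) {u : L2 d ℝ} (hu : IsMinimizer σ ω u)
    (v : L2 d ℝ) :
    0 ≤ energy ω v - (2 * σ + 1) * energy ω u * inner ℝ (potential hσ u v) v
        + 2 * σ * energy ω u * inner ℝ (potential hσ u u) v ^ 2 := by
  have hcont : Continuous fun v : L2 d ℝ => energy ω v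
      - (2 * σ + 1) * energy ω u * inner ℝ (potential hσ u v) v
        + 2 * σ * energy ω u * inner ℝ (potential hσ u u) v ^ 2 := by
    simp only [energy_eq]
    fun_prop
  exact ge_of_tendsto' ((hcont.tendsto v).comp (tendsto_truncate v))
    fun s => (hu.variation_truncate hσ v s).2

/-- Young's inequality at each site with weights `2σ/(2σ+2)` and `2/(2σ+2)`, summed; both sums equal
`1`. -/
theorem inner_potential_le_one (hσ : 0 < σ) {u v : L2 d ℝ} (hu : Constraint σ u)
    (hv : Constraint σ v) : inner ℝ (potential hσ u v) v ≤ 1 := by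
  have hp : 0 < 2 * σ + 2 := by positivity
  have hu' := hasSum_abs_rpow hσ u
  have hv' := hasSum_abs_rpow hσ v
  rw [(constraint_iff hσ u).1 hu] at hu'
  rw [(constraint_iff hσ v).1 hv] at hv'
  have h := (summable_mul (potential hσ u v) v).hasSum
  rw [← inner_eq_tsum] at h
  have hw : 2 * σ / (2 * σ + 2) + 2 / (2 * σ + 2) = 1 := by field_simp
  refine (hasSum_le (fun n => ?_) h ((hu'.mul_left (2 * σ / (2 * σ + 2))).add
    (hv'.mul_left (2 / (2 * σ + 2))))).trans_eq (by rw [mul_one, mul_one, hw])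
  have hy := Real.geom_mean_le_arith_mean2_weighted (w₁ := 2 * σ / (2 * σ + 2))
    (w₂ := 2 / (2 * σ + 2)) (p₁ := |u n| ^ (2 * σ + 2)) (p₂ := |v n| ^ (2 * σ + 2))
    (by positivity) (by positivity) (by positivity) (by positivity) hw
  rw [← Real.rpow_mul (abs_nonneg _), ← Real.rpow_mul (abs_nonneg _), mul_div_cancel₀ _ hp.ne',
    mul_div_cancel₀ _ hp.ne', Real.rpow_two, sq_abs] at hy
  refine le_trans (le_of_eq ?_) hy
  rw [potential_apply]
  ring

/-- This is `L_- ≥ 0` before rescaling: for normalized `v` the potential term is at most `energy ω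
u`, which minimality bounds by the energy of `v`. -/
theorem IsMinimizer.potential_le_energy (hσ : 0 < σ) {u : L2 d ℝ} (hu : IsMinimizer σ ω u)
    (hj : 0 ≤ energy ω u) (v : L2 d ℝ) :
    energy ω u * inner ℝ (potential hσ u v) v ≤ energy ω v := by
  rcases eq_or_ne v 0 with rfl | hv
  · simp [energy_eq]
  · obtain ⟨t, ht, hc, -⟩ := exists_constraint_smul hσ hv
    have h1 := hu.2 _ hc
    have h2 := mul_le_mul_of_nonneg_left (inner_potential_le_one hσ hu.1 hc) hj
    rw [energy_smul] at h1
    simp only [map_smul, inner_smul_left, inner_smul_right, conj_trivial] at h2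
    have ht2 : 0 < t ^ 2 := by positivity
    refine le_of_mul_le_mul_left ?_ ht2
    linarith

theorem IsMinimizer.ne_zero (hσ : 0 < σ) {u : L2 d ℝ} (hu : IsMinimizer σ ω u) : u ≠ 0 := by
  rintro rfl
  have := (constraint_iff hσ _).1 hu.1
  simp at this

theorem IsMinimizer.energy_pos (hσ : 0 < σ) (hω : 0 < ω) {u : L2 d ℝ} (hu : IsMinimizer σ ω u) :
    0 < energy ω u := by
  have h1 := norm_pos_iff.2 (hu.ne_zero hσ)
  rw [energy_eq]
  have := inner_negLaplacian_self_nonneg u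
  positivity

theorem IsMinimizer.minValue_eq {u : L2 d ℝ} (hu : IsMinimizer σ ω u) :
    minValue d σ ω = energy ω u :=
  IsLeast.csInf_eq ⟨⟨u, hu.1, rfl⟩, by rintro _ ⟨w, hw, rfl⟩; exact hu.2 w hw⟩

/-- The factor `j(ω)^{1/(2σ)}` is chosen so that `|φ|^{2σ}` absorbs the Lagrange multiplier `j(ω)`.
-/
theorem potential_wave (hσ : 0 < σ) {u : L2 d ℝ} (hj : 0 ≤ minValue d σ ω) :
    potential hσ (wave σ ω u) = minValue d σ ω • potential hσ u := by
  ext f n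
  have : |wave σ ω u n| ^ (2 * σ) = minValue d σ ω * |u n| ^ (2 * σ) := by
    rw [wave, lp.coeFn_smul, Pi.smul_apply, smul_eq_mul, abs_mul,
      abs_of_nonneg (Real.rpow_nonneg hj _), Real.mul_rpow (Real.rpow_nonneg hj _) (abs_nonneg _),
      ← Real.rpow_mul hj, one_div_mul_cancel (by positivity), Real.rpow_one]
  rw [potential_apply, this]
  simp [mul_assoc]

theorem wave_equation (hσ : 0 < σ) {u : L2 d ℝ} (hu : IsMinimizer σ ω u)
    (hj : 0 ≤ minValue d σ ω) :
    negLaplacian d (wave σ ω u) + ω • wave σ ω u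
      = potential hσ (wave σ ω u) (wave σ ω u) := by
  rw [potential_wave hσ hj, wave, map_smul, smul_comm ω, ← smul_add, hu.euler_lagrange hσ,
    ← hu.minValue_eq, smul_apply, map_smul, smul_comm]

end Minimizer

end DNLS

namespace DNLS

/-! ### The operators `L_+` and `L_-`: compactness, positivity and the kernel of `L_-`. -/

section Linearization

variable {d : ℕ} {σ ω : ℝ}

/-- `-Δ + ω` as a bounded operator. -/
noncomputable def freeOp (d : ℕ) (ω : ℝ) : L2 d ℝ →L[ℝ] L2 d ℝ :=
  negLaplacian d + ω • ContinuousLinearMap.id ℝ (L2 d ℝ)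

/-- `L_+` as a bounded operator. -/
noncomputable def LplusOp (hσ : 0 < σ) (ω : ℝ) (φ : L2 d ℝ) : L2 d ℝ →L[ℝ] L2 d ℝ :=
  freeOp d ω - (2 * σ + 1) • potential hσ φ

/-- `L_-` as a bounded operator. -/
noncomputable def LminusOp (hσ : 0 < σ) (ω : ℝ) (φ : L2 d ℝ) : L2 d ℝ →L[ℝ] L2 d ℝ :=
  freeOp d ω - potential hσ φ

theorem freeOp_apply (ω : ℝ) (f : L2 d ℝ) : freeOp d ω f = negLaplacian d f + ω • f := rfl

theorem LplusOp_apply (hσ : 0 < σ) (ω : ℝ) (φ f : L2 d ℝ) (n : Lattice d) :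
    LplusOp hσ ω φ f n = Lplus σ ω (fun m => φ m) (fun m => f m) n := by
  have : LplusOp hσ ω φ f n
      = negLaplacian d f n + ω * f n - (2 * σ + 1) * (|φ n| ^ (2 * σ) * f n) := rfl
  rw [this, negLaplacian_apply, Lplus, smul_eq_mul, smul_eq_mul]
  ring

theorem LminusOp_apply (hσ : 0 < σ) (ω : ℝ) (φ f : L2 d ℝ) (n : Lattice d) :
    LminusOp hσ ω φ f n = Lminus σ ω (fun m => φ m) (fun m => f m) n := by
  have : LminusOp hσ ω φ f n = negLaplacian d f n + ω * f n - |φ n| ^ (2 * σ) * f n := rfl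
  rw [this, negLaplacian_apply, Lminus, smul_eq_mul, smul_eq_mul]

theorem inner_freeOp (ω : ℝ) (f g : L2 d ℝ) :
    inner ℝ (freeOp d ω f) g = inner ℝ f (freeOp d ω g) := by
  simp only [freeOp_apply, inner_add_left, inner_add_right, inner_negLaplacian, inner_smul_left,
    inner_smul_right, conj_trivial]

theorem inner_freeOp_self (ω : ℝ) (f : L2 d ℝ) : inner ℝ (freeOp d ω f) f = energy ω f := by
  rw [freeOp_apply, inner_add_left, inner_smul_left, energy_eq, real_inner_self_eq_norm_sq,
    conj_trivial]

theorem freeOp_coercive (ω : ℝ) (f : L2 d ℝ) : ω * ‖f‖ ^ 2 ≤ inner ℝ (freeOp d ω f) f := by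
  rw [inner_freeOp_self, energy_eq]
  linarith [inner_negLaplacian_self_nonneg f]

theorem inner_LplusOp (hσ : 0 < σ) (ω : ℝ) (φ f g : L2 d ℝ) :
    inner ℝ (LplusOp hσ ω φ f) g = inner ℝ f (LplusOp hσ ω φ g) := by
  simp only [LplusOp, sub_apply, smul_apply, inner_sub_left, inner_sub_right, inner_freeOp,
    inner_smul_left, inner_smul_right, inner_potential, conj_trivial]

theorem inner_LminusOp (hσ : 0 < σ) (ω : ℝ) (φ f g : L2 d ℝ) :
    inner ℝ (LminusOp hσ ω φ f) g = inner ℝ f (LminusOp hσ ω φ g) := by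
  simp only [LminusOp, sub_apply, inner_sub_left, inner_sub_right, inner_freeOp, inner_potential]

/-- Square summability forces `φ n ^ 2 → 0` at infinity, and the multiplier is its `σ`-th power. -/
theorem isCompactOperator_potential (hσ : 0 < σ) (φ : L2 d ℝ) :
    IsCompactOperator (potential hσ φ) := by
  refine isCompactOperator_mulOp _ ?_
  have h := ((summable_sq φ).tendsto_cofinite_zero).rpow_const (p := σ) (Or.inr hσ.le)
  rw [Real.zero_rpow hσ.ne'] at h
  refine h.congr fun n => ?_
  rw [← sq_abs, ← Real.rpow_two, ← Real.rpow_mul (abs_nonneg _)]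

theorem isUnit_LplusOp (hσ : 0 < σ) (hω : 0 < ω) (φ : L2 d ℝ)
    (hker : ∀ f, LplusOp hσ ω φ f = 0 → f = 0) : IsUnit (LplusOp hσ ω φ) := by
  rw [LplusOp, sub_eq_add_neg]
  refine isUnit_coercive_add_compact hω (freeOp_coercive ω)
    ((isCompactOperator_potential hσ φ).smul (2 * σ + 1)).neg fun x hx => hker x ?_
  rw [← hx, LplusOp]
  simp [sub_eq_add_neg]

theorem inner_LminusOp_absSeq_le (hσ : 0 < σ) (ω : ℝ) (φ f : L2 d ℝ) :
    inner ℝ (LminusOp hσ ω φ (absSeq f)) (absSeq f) ≤ inner ℝ (LminusOp hσ ω φ f) f := by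
  have h1 : inner ℝ (potential hσ φ (absSeq f)) (absSeq f) = inner ℝ (potential hσ φ f) f := by
    rw [inner_eq_tsum, inner_eq_tsum]
    exact tsum_congr fun n => by simp [mul_assoc]
  have h2 : ‖absSeq f‖ ^ 2 = ‖f‖ ^ 2 := by
    rw [norm_sq_eq_tsum, norm_sq_eq_tsum]
    exact tsum_congr fun n => by simp
  rw [LminusOp, sub_apply, sub_apply, inner_sub_left, inner_sub_left, inner_freeOp_self,
    inner_freeOp_self, energy_eq, energy_eq, h1, h2]
  linarith [inner_negLaplacian_absSeq_le f]

/-- A null vector of a nonnegative `L_-` that vanishes at one site is zero. -/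
theorem eq_zero_of_LminusOp_eq_zero (hσ : 0 < σ) {φ f : L2 d ℝ}
    (hpos : ∀ g, 0 ≤ inner ℝ (LminusOp hσ ω φ g) g) (hf : LminusOp hσ ω φ f = 0)
    {n₀ : Lattice d} (h0 : f n₀ = 0) : f = 0 := by
  -- Passing to `|f|` does not raise the form, so `|f|` is a null vector too, and the maximum
  -- principle applies to it.
  have h1 : inner ℝ (LminusOp hσ ω φ (absSeq f)) (absSeq f) = 0 := by
    refine le_antisymm ((inner_LminusOp_absSeq_le hσ ω φ f).trans_eq ?_) (hpos _)
    rw [hf, inner_zero_left]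
  have h2 := map_eq_zero_of_inner_eq_zero (inner_LminusOp hσ ω φ) hpos h1
  have h3 := eq_zero_of_apply_eq_zero (f := fun n => absSeq f n) (fun n => abs_nonneg _)
    (fun n hn => by
      have h4 : LminusOp hσ ω φ (absSeq f) n = 0 := by rw [h2]; rfl
      rw [LminusOp_apply, Lminus] at h4
      rw [show absSeq f n = 0 from hn, smul_zero, smul_zero, add_zero, sub_zero] at h4
      exact neg_eq_zero.1 h4) (n₀ := n₀) (by simp [h0])
  exact lp.ext (funext fun n => by simpa using h3 n)

/-- Subtract the multiple of `φ` that makes the difference vanish at the origin; this is possible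
because `φ` vanishes nowhere. -/
theorem exists_smul_of_LminusOp_eq_zero (hσ : 0 < σ) {φ f : L2 d ℝ}
    (hpos : ∀ g, 0 ≤ inner ℝ (LminusOp hσ ω φ g) g) (hφ0 : φ ≠ 0)
    (hφ : LminusOp hσ ω φ φ = 0) (hf : LminusOp hσ ω φ f = 0) : ∃ a : ℝ, f = a • φ := by
  have h0 : φ 0 ≠ 0 := fun h => hφ0 (eq_zero_of_LminusOp_eq_zero hσ hpos hφ h)
  refine ⟨f 0 / φ 0, sub_eq_zero.1 (eq_zero_of_LminusOp_eq_zero hσ hpos (n₀ := 0) ?_ ?_)⟩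
  · rw [map_sub, map_smul, hf, hφ, smul_zero, sub_zero]
  · rw [lp.coeFn_sub, lp.coeFn_smul, Pi.sub_apply, Pi.smul_apply, smul_eq_mul,
      div_mul_cancel₀ _ h0, sub_self]

theorem IsMinimizer.minValue_pos (hσ : 0 < σ) (hω : 0 < ω) {u : L2 d ℝ}
    (hu : IsMinimizer σ ω u) : 0 < minValue d σ ω := by
  rw [hu.minValue_eq]; exact hu.energy_pos hσ hω

theorem IsMinimizer.wave_ne_zero (hσ : 0 < σ) (hω : 0 < ω) {u : L2 d ℝ}
    (hu : IsMinimizer σ ω u) : wave σ ω u ≠ 0 :=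
  smul_ne_zero (Real.rpow_pos_of_pos (hu.minValue_pos hσ hω) _).ne' (hu.ne_zero hσ)

theorem IsMinimizer.LminusOp_wave (hσ : 0 < σ) (hω : 0 < ω) {u : L2 d ℝ}
    (hu : IsMinimizer σ ω u) : LminusOp hσ ω (wave σ ω u) (wave σ ω u) = 0 := by
  rw [LminusOp, sub_apply, freeOp_apply, wave_equation hσ hu (hu.minValue_pos hσ hω).le, sub_self]

/-- It shows both that `φ` is a negative direction of `L_+` and that `⟨L_+⁻¹ φ, |φ|^{2σ} φ⟩` is
nonzero. -/
theorem IsMinimizer.LplusOp_wave (hσ : 0 < σ) (hω : 0 < ω) {u : L2 d ℝ}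
    (hu : IsMinimizer σ ω u) : LplusOp hσ ω (wave σ ω u) (wave σ ω u)
      = (-(2 * σ)) • potential hσ (wave σ ω u) (wave σ ω u) := by
  rw [LplusOp, sub_apply, freeOp_apply, wave_equation hσ hu (hu.minValue_pos hσ hω).le,
    smul_apply]
  module

theorem IsMinimizer.LminusOp_nonneg (hσ : 0 < σ) (hω : 0 < ω) {u : L2 d ℝ}
    (hu : IsMinimizer σ ω u) (f : L2 d ℝ) :
    0 ≤ inner ℝ (LminusOp hσ ω (wave σ ω u) f) f := by
  have h := hu.potential_le_energy hσ (hu.energy_pos hσ hω).le f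
  rw [LminusOp, sub_apply, inner_sub_left, inner_freeOp_self,
    potential_wave hσ (hu.minValue_pos hσ hω).le, smul_apply, inner_smul_left, hu.minValue_eq]
  exact sub_nonneg.2 h

/-- On directions tangent to the constraint the squared term of the second variation drops out,
leaving the form of `L_+`. -/
theorem IsMinimizer.LplusOp_nonneg (hσ : 0 < σ) (hω : 0 < ω) {u : L2 d ℝ}
    (hu : IsMinimizer σ ω u) (f : L2 d ℝ)
    (hf : inner ℝ f (potential hσ (wave σ ω u) (wave σ ω u)) = 0) :
    0 ≤ inner ℝ (LplusOp hσ ω (wave σ ω u) f) f := by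
  have hj := hu.minValue_pos hσ hω
  have h := hu.second_variation hσ f
  rw [potential_wave hσ hj.le, wave, smul_apply, map_smul, inner_smul_right, inner_smul_right,
    mul_eq_zero, mul_eq_zero, or_iff_right hj.ne',
    or_iff_right (Real.rpow_pos_of_pos hj _).ne', real_inner_comm] at hf
  rw [hf] at h
  rw [LplusOp, sub_apply, inner_sub_left, inner_freeOp_self, smul_apply, inner_smul_left,
    potential_wave hσ hj.le, smul_apply, inner_smul_left, hu.minValue_eq, conj_trivial,
    conj_trivial]
  linarith

end Linearization

/-! ### Passage to the limit along the increments and differentiation of the wave. -/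

section Limits

variable {d : ℕ} {σ ω : ℝ}

theorem eventually_abs_sub_lt {v : ℕ → L2 d ℝ} {u : L2 d ℝ} (h : Tendsto v atTop (𝓝 u)) {ε : ℝ}
    (hε : 0 < ε) : ∀ᶠ j in atTop, ∀ n, |v j n - u n| < ε := by
  filter_upwards [Metric.tendsto_nhds.1 h ε hε] with j hj n
  rw [dist_eq_norm] at hj
  exact (abs_apply_le_norm (v j - u) n).trans_lt hj

theorem eventually_abs_le {v : ℕ → L2 d ℝ} {u : L2 d ℝ} (h : Tendsto v atTop (𝓝 u)) :
    ∀ᶠ j in atTop, ∀ n, |v j n| ≤ ‖u‖ + 1 := by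
  filter_upwards [(tendsto_order.1 h.norm).2 _ (lt_add_one ‖u‖)] with j hj n
  exact (abs_apply_le_norm _ n).trans hj.le

/-- Convergence in `ℓ²` is uniform over sites, and the operator norm of a multiplication is bounded
by the supremum of its multiplier. -/
theorem tendsto_potential (hσ : 0 < σ) {v : ℕ → L2 d ℝ} {u : L2 d ℝ}
    (h : Tendsto v atTop (𝓝 u)) :
    Tendsto (fun j => potential hσ (v j)) atTop (𝓝 (potential hσ u)) := by
  rw [Metric.tendsto_nhds]
  intro ε hε
  obtain ⟨δ, hδ, hu⟩ := uniform_abs_rpow (by positivity : 0 < 2 * σ) (‖u‖ + 1) (half_pos hε)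
  filter_upwards [eventually_abs_sub_lt h hδ, eventually_abs_le h] with j h1 h2
  rw [dist_eq_norm]
  refine (ContinuousLinearMap.opNorm_le_bound _ (half_pos hε).le fun f => ?_).trans_lt
    (half_lt_self hε)
  refine norm_le_of_abs_le (half_pos hε).le fun n => ?_
  have h3 := hu (v j n) (u n) (h2 n) ((abs_apply_le_norm u n).trans (by linarith)) (h1 n)
  have h4 : (potential hσ (v j) - potential hσ u) f n
      = (|v j n| ^ (2 * σ) - |u n| ^ (2 * σ)) * f n := by
    rw [sub_mul]; rfl
  rw [h4, abs_mul]
  exact mul_le_mul_of_nonneg_right h3.le (abs_nonneg _)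

theorem tendsto_inner_potential (hσ : 0 < σ) {v : ℕ → L2 d ℝ} {u : L2 d ℝ}
    (h : Tendsto v atTop (𝓝 u)) :
    Tendsto (fun j => inner ℝ (potential hσ (v j) (v j)) (v j)) atTop
      (𝓝 (inner ℝ (potential hσ u u) u)) :=
  ((isBoundedBilinearMap_apply.continuous.tendsto (potential hσ u, u)).comp
    ((tendsto_potential hσ h).prodMk_nhds h)).inner h

theorem tendsto_energy {δ : ℕ → ℝ} {v : ℕ → L2 d ℝ} {u : L2 d ℝ} (hδ : Tendsto δ atTop (𝓝 0))
    (h : Tendsto v atTop (𝓝 u)) :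
    Tendsto (fun j => energy (ω + δ j) (v j)) atTop (𝓝 (energy ω u)) := by
  simp only [energy_eq]
  have h1 : Tendsto (fun j => negLaplacian d (v j)) atTop (𝓝 (negLaplacian d u)) :=
    ((negLaplacian d).continuous.tendsto u).comp h
  have h2 : Tendsto (fun j => ω + δ j) atTop (𝓝 ω) := by
    simpa using hδ.const_add ω
  exact (h1.inner h).add (h2.mul (h.norm.pow 2))

theorem IsLimitWaveAlong.isMinimizer_limit (hσ : 0 < σ) {δ : ℕ → ℝ} {v : ℕ → L2 d ℝ}
    {u : L2 d ℝ} (h : IsLimitWaveAlong σ ω δ v u) : IsMinimizer σ ω u := by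
  refine ⟨?_, fun w hw => ?_⟩
  · rw [constraint_iff hσ]
    refine tendsto_nhds_unique (tendsto_inner_potential hσ h.wave_tendsto) ?_
    exact tendsto_const_nhds.congr fun j => ((constraint_iff hσ _).1 (h.isMinimizer j).1).symm
  · exact le_of_tendsto_of_tendsto' (tendsto_energy h.increment_tendsto h.wave_tendsto)
      (tendsto_energy h.increment_tendsto tendsto_const_nhds) fun j => (h.isMinimizer j).2 w hw

theorem IsLimitWaveAlong.tendsto_minValue (hσ : 0 < σ) {δ : ℕ → ℝ} {v : ℕ → L2 d ℝ}
    {u : L2 d ℝ} (h : IsLimitWaveAlong σ ω δ v u) :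
    Tendsto (fun j => minValue d σ (ω + δ j)) atTop (𝓝 (minValue d σ ω)) := by
  rw [(h.isMinimizer_limit hσ).minValue_eq]
  exact (tendsto_energy h.increment_tendsto h.wave_tendsto).congr fun j =>
    (h.isMinimizer j).minValue_eq.symm

theorem IsLimitWaveAlong.tendsto_wave (hσ : 0 < σ) (hω : 0 < ω) {δ : ℕ → ℝ} {v : ℕ → L2 d ℝ}
    {u : L2 d ℝ} (h : IsLimitWaveAlong σ ω δ v u) :
    Tendsto (fun j => wave σ (ω + δ j) (v j)) atTop (𝓝 (wave σ ω u)) :=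
  ((h.tendsto_minValue hσ).rpow_const
    (Or.inl ((h.isMinimizer_limit hσ).minValue_pos hσ hω).ne')).smul h.wave_tendsto

/-- The equations for the waves, linearized at the limit. -/
theorem IsLimitWaveAlong.eventually_norm_remainder_le (hσ : 0 < σ) (hω : 0 < ω) {δ : ℕ → ℝ}
    {v : ℕ → L2 d ℝ} {u : L2 d ℝ} (h : IsLimitWaveAlong σ ω δ v u) {ε : ℝ} (hε : 0 < ε) :
    ∀ᶠ j in atTop, ‖LplusOp hσ ω (wave σ ω u) (wave σ (ω + δ j) (v j) - wave σ ω u)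
      + δ j • wave σ (ω + δ j) (v j)‖ ≤ ε * ‖wave σ (ω + δ j) (v j) - wave σ ω u‖ := by
  have hmin := h.isMinimizer_limit hσ
  have hj0 := hmin.minValue_pos hσ hω
  set φ := wave σ ω u
  obtain ⟨η, hη, hr⟩ := abs_rpow_mul_self_remainder (by positivity : 0 < 2 * σ) (‖φ‖ + 1) hε
  have hw := h.tendsto_wave hσ hω
  filter_upwards [eventually_abs_sub_lt hw hη, eventually_abs_le hw,
    (tendsto_order.1 (h.tendsto_minValue hσ)).1 0 hj0] with j h1 h2 h3
  set ψ := wave σ (ω + δ j) (v j)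
  have e1 : negLaplacian d φ + ω • φ = potential hσ φ φ := wave_equation hσ hmin hj0.le
  have e2 : negLaplacian d ψ + (ω + δ j) • ψ = potential hσ ψ ψ :=
    wave_equation hσ (h.isMinimizer j) h3.le
  -- Subtracting the two wave equations leaves the first-order Taylor remainder of the nonlinearity,
  -- estimated site by site.
  have e3 : LplusOp hσ ω φ (ψ - φ) + δ j • ψ
      = potential hσ ψ ψ - potential hσ φ φ - (2 * σ + 1) • potential hσ φ (ψ - φ) := by
    rw [← e1, ← e2, LplusOp, sub_apply, freeOp_apply, smul_apply, map_sub]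
    module
  rw [e3]
  refine norm_le_of_abs_le hε.le fun n => ?_
  have h4 := hr (φ n) (ψ n) ((abs_apply_le_norm φ n).trans (by linarith)) (h2 n) (h1 n)
  rw [mul_assoc] at h4
  exact h4

/-- Differentiability along the increments, for the inverse `R` of `L_+`. -/
theorem IsLimitWaveAlong.tendsto_difference_quotient (hσ : 0 < σ) (hω : 0 < ω) {δ : ℕ → ℝ}
    {v : ℕ → L2 d ℝ} {u : L2 d ℝ} (h : IsLimitWaveAlong σ ω δ v u) {R : L2 d ℝ →L[ℝ] L2 d ℝ}
    (hR : ∀ f, R (LplusOp hσ ω (wave σ ω u) f) = f) :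
    Tendsto (fun j => (δ j)⁻¹ • (wave σ (ω + δ j) (v j) - wave σ ω u)) atTop
      (𝓝 (-R (wave σ ω u))) := by
  have hw := h.tendsto_wave hσ hω
  have hrem := fun ε (hε : (0 : ℝ) < ε) => h.eventually_norm_remainder_le hσ hω hε
  set φ := wave σ ω u
  set ψ : ℕ → L2 d ℝ := fun j => wave σ (ω + δ j) (v j)
  set L := LplusOp hσ ω φ
  set K := ‖R‖ + 1 with hK
  have hK0 : 0 < K := by positivity
  have hRK : ∀ f, ‖R f‖ ≤ K * ‖f‖ := fun f =>
    (R.le_opNorm f).trans (mul_le_mul_of_nonneg_right (by linarith) (norm_nonneg _))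
  -- A priori bound `‖ψ - φ‖ = O(|δ|)`: with remainder constant `1 / (2K)`, half of `‖ψ - φ‖` is
  -- absorbed on the left.
  have hbound : ∀ᶠ j in atTop, ‖ψ j - φ‖ ≤ 2 * K * (‖φ‖ + 1) * |δ j| := by
    filter_upwards [hrem (1 / (2 * K)) (by positivity),
      (tendsto_order.1 hw.norm).2 _ (lt_add_one ‖φ‖)] with j h1 h2
    have h3 : ‖ψ j - φ‖ ≤ K * ‖L (ψ j - φ)‖ := by
      have := hRK (L (ψ j - φ))
      rwa [hR] at this
    have h4 : ‖L (ψ j - φ)‖ ≤ 1 / (2 * K) * ‖ψ j - φ‖ + |δ j| * (‖φ‖ + 1) := by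
      have h5 := norm_sub_le (L (ψ j - φ) + δ j • ψ j) (δ j • ψ j)
      rw [add_sub_cancel_right, norm_smul, Real.norm_eq_abs] at h5
      have h6 := mul_le_mul_of_nonneg_left h2.le (abs_nonneg (δ j))
      exact h5.trans (add_le_add h1 h6)
    have h7 := mul_le_mul_of_nonneg_left h4 hK0.le
    have h8 : K * (1 / (2 * K) * ‖ψ j - φ‖ + |δ j| * (‖φ‖ + 1))
        = ‖ψ j - φ‖ / 2 + K * (‖φ‖ + 1) * |δ j| := by field_simp
    rw [h8] at h7
    linarith
  -- By the a priori bound the remainder is now `o(|δ|)`, so it survives division by `δ` and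
  -- application of `R`.
  have hsmall : Tendsto (fun j => (δ j)⁻¹ • (ψ j - φ) + R (ψ j)) atTop (𝓝 0) := by
    rw [Metric.tendsto_nhds]
    intro ε hε
    set M := K * (2 * K * (‖φ‖ + 1)) with hM
    have hM0 : 0 < M := by positivity
    filter_upwards [hbound, hrem (ε / (2 * M)) (by positivity)] with j h1 h2
    have hδ : 0 < |δ j| := abs_pos.2 (h.increment_ne_zero j)
    have h3 : (δ j)⁻¹ • (ψ j - φ) + R (ψ j) = (δ j)⁻¹ • R (L (ψ j - φ) + δ j • ψ j) := by
      rw [map_add, hR, map_smul, smul_add, inv_smul_smul₀ (h.increment_ne_zero j)]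
    rw [dist_zero_right, h3, norm_smul, norm_inv, Real.norm_eq_abs, inv_mul_lt_iff₀ hδ]
    calc ‖R (L (ψ j - φ) + δ j • ψ j)‖ ≤ K * (ε / (2 * M) * (2 * K * (‖φ‖ + 1) * |δ j|)) := by
          refine (hRK _).trans (mul_le_mul_of_nonneg_left ?_ hK0.le)
          exact h2.trans (mul_le_mul_of_nonneg_left h1 (by positivity))
      _ = (ε / (2 * M)) * M * |δ j| := by rw [hM]; ring
      _ = |δ j| * (ε / 2) := by field_simp
      _ < |δ j| * ε := by
          exact mul_lt_mul_of_pos_left (half_lt_self hε) hδ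
  have hlim := hsmall.sub ((R.continuous.tendsto φ).comp hw)
  simpa using hlim

/-- The difference of squared norms is `⟨ψ - φ, ψ + φ⟩`, so the quotient converges as an inner
product of two convergent sequences. -/
theorem IsLimitWaveAlong.tendsto_slope (hσ : 0 < σ) (hω : 0 < ω) {δ : ℕ → ℝ}
    {v : ℕ → L2 d ℝ} {u : L2 d ℝ} (h : IsLimitWaveAlong σ ω δ v u) {R : L2 d ℝ →L[ℝ] L2 d ℝ}
    (hR : ∀ f, R (LplusOp hσ ω (wave σ ω u) f) = f) :
    Tendsto (fun j => (‖wave σ (ω + δ j) (v j)‖ ^ 2 - ‖wave σ ω u‖ ^ 2) / δ j) atTop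
      (𝓝 (-2 * inner ℝ (R (wave σ ω u)) (wave σ ω u))) := by
  have h1 := (h.tendsto_difference_quotient hσ hω hR).inner (𝕜 := ℝ)
    ((h.tendsto_wave hσ hω).add_const (wave σ ω u))
  have h2 : inner ℝ (-R (wave σ ω u)) (wave σ ω u + wave σ ω u)
      = -2 * inner ℝ (R (wave σ ω u)) (wave σ ω u) := by
    rw [inner_neg_left, inner_add_right]; ring
  rw [h2] at h1
  refine h1.congr fun j => ?_
  rw [inner_smul_left, inner_add_right, inner_sub_left, inner_sub_left,
    real_inner_self_eq_norm_sq, real_inner_self_eq_norm_sq,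
    real_inner_comm (wave σ ω u) (wave σ (ω + δ j) (v j)), conj_trivial]
  ring

end Limits

end DNLS

namespace DNLS

/-! ### Translation between complex modes and pairs of real sequences. -/

section Complexification

variable {d : ℕ} {σ ω : ℝ}

theorem summable_norm_sq (f : L2 d ℂ) : Summable fun n => ‖f n‖ ^ 2 := by
  have h := (lp.memℓp f).summable (by norm_num)
  simpa using h

/-- The real part of a complex sequence. -/
noncomputable def reSeq (f : L2 d ℂ) : L2 d ℝ :=
  ⟨fun n => (f n).re, memℓp_two_of_summable (Summable.of_nonneg_of_le (fun _ => sq_nonneg _)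
    (fun _ => sq_le_sq' (neg_le_of_abs_le (Complex.abs_re_le_norm _)) (Complex.re_le_norm _))
    (summable_norm_sq f))⟩

/-- The imaginary part of a complex sequence. -/
noncomputable def imSeq (f : L2 d ℂ) : L2 d ℝ :=
  ⟨fun n => (f n).im, memℓp_two_of_summable (Summable.of_nonneg_of_le (fun _ => sq_nonneg _)
    (fun _ => sq_le_sq' (neg_le_of_abs_le (Complex.abs_im_le_norm _)) (Complex.im_le_norm _))
    (summable_norm_sq f))⟩

/-- A real sequence as a complex one. -/
noncomputable def complexSeq (f : L2 d ℝ) : L2 d ℂ :=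
  ⟨fun n => (f n : ℂ), memℓp_gen (by simpa using summable_sq f)⟩

theorem eq_zero_of_reSeq_imSeq {f : L2 d ℂ} (h1 : reSeq f = 0) (h2 : imSeq f = 0) : f = 0 := by
  refine lp.ext (funext fun n => Complex.ext ?_ ?_)
  · have : reSeq f n = 0 := by rw [h1]; rfl
    exact this
  · have : imSeq f n = 0 := by rw [h2]; rfl
    exact this

theorem complexSeq_ne_zero {f : L2 d ℝ} (hf : f ≠ 0) : complexSeq f ≠ 0 := by
  intro h
  refine hf (lp.ext (funext fun n => ?_))
  have : complexSeq f n = 0 := by rw [h]; rfl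
  exact Complex.ofReal_eq_zero.1 this

/-- The coefficients are real, so real parts, imaginary parts and the inclusion of the reals all
commute with the operator. -/
theorem map_Lplus {E F : Type} [AddCommGroup E] [Module ℝ E] [AddCommGroup F] [Module ℝ F]
    (T : E →ₗ[ℝ] F) (σ ω : ℝ) (φ : Lattice d → ℝ) (f : Lattice d → E) (n : Lattice d) :
    T (Lplus σ ω φ f n) = Lplus σ ω φ (fun m => T (f m)) n := by
  simp only [Lplus, discLaplacian, map_sub, map_add, map_neg, map_smul, map_sum]

theorem map_Lminus {E F : Type} [AddCommGroup E] [Module ℝ E] [AddCommGroup F] [Module ℝ F]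
    (T : E →ₗ[ℝ] F) (σ ω : ℝ) (φ : Lattice d → ℝ) (f : Lattice d → E) (n : Lattice d) :
    T (Lminus σ ω φ f n) = Lminus σ ω φ (fun m => T (f m)) n := by
  simp only [Lminus, discLaplacian, map_sub, map_add, map_neg, map_smul, map_sum]

theorem spectrallyStable_of_nonneg (hσ : 0 < σ) {φ : L2 d ℝ}
    (hpos : ∀ x, 0 ≤ inner ℝ (LminusOp hσ ω φ x) x) (hφ : LminusOp hσ ω φ φ = 0)
    (hLp : ∀ x, inner ℝ x φ = 0 → 0 ≤ inner ℝ (LplusOp hσ ω φ x) x) :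
    SpectrallyStable σ ω (fun m => φ m) := by
  rintro ⟨μ, f, g, hμ, hne, h1, h2⟩
  have e1 : -LminusOp hσ ω φ (reSeq g) = μ.re • reSeq f - μ.im • imSeq f := by
    refine lp.ext (funext fun n => ?_)
    have h := congrArg Complex.reLm (h1 n)
    rw [map_neg, map_Lminus] at h
    rw [lp.coeFn_neg, Pi.neg_apply, LminusOp_apply]
    exact h.trans (Complex.mul_re _ _)
  have e2 : -LminusOp hσ ω φ (imSeq g) = μ.re • imSeq f + μ.im • reSeq f := by
    refine lp.ext (funext fun n => ?_)
    have h := congrArg Complex.imLm (h1 n)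
    rw [map_neg, map_Lminus] at h
    rw [lp.coeFn_neg, Pi.neg_apply, LminusOp_apply]
    exact h.trans (Complex.mul_im _ _)
  have e3 : LplusOp hσ ω φ (reSeq f) = μ.re • reSeq g - μ.im • imSeq g := by
    refine lp.ext (funext fun n => ?_)
    have h := congrArg Complex.reLm (h2 n)
    rw [map_Lplus] at h
    rw [LplusOp_apply]
    exact h.trans (Complex.mul_re _ _)
  have e4 : LplusOp hσ ω φ (imSeq f) = μ.re • imSeq g + μ.im • reSeq g := by
    refine lp.ext (funext fun n => ?_)
    have h := congrArg Complex.imLm (h2 n)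
    rw [map_Lplus] at h
    rw [LplusOp_apply]
    exact h.trans (Complex.mul_im _ _)
  obtain ⟨hf1, hf2, hg1, hg2⟩ := no_growing_mode (inner_LplusOp hσ ω φ) (inner_LminusOp hσ ω φ)
    hpos hφ hLp hμ e1 e2 e3 e4
  exact hne.elim (fun h => h (eq_zero_of_reSeq_imSeq hf1 hf2))
    fun h => h (eq_zero_of_reSeq_imSeq hg1 hg2)

theorem not_spectrallyStable_of_mode (hσ : 0 < σ) {φ f g : L2 d ℝ} {μ : ℝ} (hμ : 0 < μ)
    (hf : f ≠ 0) (h1 : -LminusOp hσ ω φ g = μ • f) (h2 : LplusOp hσ ω φ f = μ • g) :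
    ¬ SpectrallyStable σ ω (fun m => φ m) := by
  refine not_not.2 ⟨μ, complexSeq f, complexSeq g, by simpa using hμ,
    Or.inl (complexSeq_ne_zero hf), fun n => ?_, fun n => ?_⟩
  · have h := congrArg (fun w : L2 d ℝ => Complex.ofRealAm.toLinearMap (w n)) h1
    simp only [lp.coeFn_neg, Pi.neg_apply, LminusOp_apply, map_neg, map_Lminus] at h
    exact h.trans (Complex.ofReal_mul _ _)
  · have h := congrArg (fun w : L2 d ℝ => Complex.ofRealAm.toLinearMap (w n)) h2
    simp only [LplusOp_apply, map_Lplus] at h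
    exact h.trans (Complex.ofReal_mul _ _)

end Complexification

end DNLS

/-! ### Assembly of the slope formula and the stability criterion. -/

theorem theorem2p4 (d : ℕ) (hd : 1 ≤ d) (σ ω : ℝ) (hσ : 0 < σ) (hω : 0 < ω)
    (δ : ℕ → ℝ) (v : ℕ → DNLS.L2 d ℝ) (u : DNLS.L2 d ℝ)
    (hlim : DNLS.IsLimitWaveAlong σ ω δ v u)
    (φ : DNLS.L2 d ℝ) (hφ : φ = DNLS.wave σ ω u)
    (hker : ∀ f : DNLS.L2 d ℝ,
      (∀ n, DNLS.Lplus σ ω (fun m => φ m) (fun m => f m) n = 0) → f = 0) :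
    -- `R` is the bounded inverse of `L_+` on `ℓ²`
    ∃ R : DNLS.L2 d ℝ →L[ℝ] DNLS.L2 d ℝ,
      (∀ f g : DNLS.L2 d ℝ,
        (∀ n, DNLS.Lplus σ ω (fun m => φ m) (fun m => f m) n = g n) ↔ R g = f) ∧
      Tendsto (fun j => (‖DNLS.wave σ (ω + δ j) (v j)‖ ^ 2 - ‖φ‖ ^ 2) / δ j) atTop
        (𝓝 (-2 * inner ℝ (R φ) φ)) ∧
      (0 ≤ -2 * inner ℝ (R φ) φ → DNLS.SpectrallyStable σ ω (fun m => φ m)) ∧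
      (-2 * inner ℝ (R φ) φ < 0 → ¬ DNLS.SpectrallyStable σ ω (fun m => φ m)) := by
  have hmin := hlim.isMinimizer_limit hσ
  have hφ0 : φ ≠ 0 := hφ ▸ hmin.wave_ne_zero hσ hω
  have hpos : ∀ x, 0 ≤ inner ℝ (DNLS.LminusOp hσ ω φ x) x := hφ ▸ hmin.LminusOp_nonneg hσ hω
  have hLm : DNLS.LminusOp hσ ω φ φ = 0 := hφ ▸ hmin.LminusOp_wave hσ hω
  have hLpφ : DNLS.LplusOp hσ ω φ φ = (-(2 * σ)) • DNLS.potential hσ φ φ :=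
    hφ ▸ hmin.LplusOp_wave hσ hω
  have hLpχ : ∀ x, inner ℝ x (DNLS.potential hσ φ φ) = 0 →
      0 ≤ inner ℝ (DNLS.LplusOp hσ ω φ x) x := hφ ▸ hmin.LplusOp_nonneg hσ hω
  have hiff : ∀ f g : DNLS.L2 d ℝ, (∀ n, DNLS.Lplus σ ω (fun m => φ m) (fun m => f m) n = g n)
      ↔ DNLS.LplusOp hσ ω φ f = g := fun f g => by
    simp only [← DNLS.LplusOp_apply hσ]
    exact ⟨fun h => lp.ext (funext h), fun h n => by rw [h]⟩
  obtain ⟨U, hU⟩ := DNLS.isUnit_LplusOp hσ hω φ fun f hf => hker f ((hiff f 0).2 hf)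
  have hRL : ∀ f, (↑U⁻¹ : DNLS.L2 d ℝ →L[ℝ] DNLS.L2 d ℝ) (DNLS.LplusOp hσ ω φ f) = f := fun f => by
    rw [← hU, ← mul_apply_eq_comp, Units.inv_mul]; rfl
  have hLR : ∀ f, DNLS.LplusOp hσ ω φ ((↑U⁻¹ : DNLS.L2 d ℝ →L[ℝ] DNLS.L2 d ℝ) f) = f := fun f => by
    rw [← hU, ← mul_apply_eq_comp, Units.mul_inv]; rfl
  set R : DNLS.L2 d ℝ →L[ℝ] DNLS.L2 d ℝ := ↑U⁻¹
  -- Symmetry and `L_+ φ = -2σ χ` give `-2σ ⟨R φ, χ⟩ = ‖φ‖²`, where `χ = |φ|^{2σ} φ`.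
  have hψχ : inner ℝ (R φ) (DNLS.potential hσ φ φ) ≠ 0 := by
    intro h0
    have h1 : inner ℝ (R φ) (DNLS.LplusOp hσ ω φ φ) = 0 := by
      rw [hLpφ, inner_smul_right, h0, mul_zero]
    rw [← DNLS.inner_LplusOp, hLR] at h1
    exact hφ0 (inner_self_eq_zero.1 h1)
  refine ⟨R, fun f g => ?_, ?_, fun hs => ?_, fun hs => ?_⟩
  · rw [hiff]
    exact ⟨fun h => by rw [← h, hRL], fun h => by rw [← h, hLR]⟩
  · subst hφ
    exact hlim.tendsto_slope hσ hω hRL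
  · exact DNLS.spectrallyStable_of_nonneg hσ hpos hLm fun x hx =>
      DNLS.nonneg_on_orthogonal (DNLS.inner_LplusOp hσ ω φ) (hLR φ) hLpχ hψχ (by linarith) hx
  · have hneg : inner ℝ (DNLS.LplusOp hσ ω φ φ) φ < 0 := by
      rw [hLpφ, inner_smul_left, conj_trivial]
      have := DNLS.inner_potential_self_pos hσ hφ0
      nlinarith
    obtain ⟨x, hxφ, hx⟩ := DNLS.exists_neg_on_orthogonal (DNLS.inner_LplusOp hσ ω φ) (hLR φ) hneg
      (by linarith)
    have hcomp := DNLS.isCompactOperator_potential hσ φ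
    obtain ⟨μ, f, g, hμ, hf, h1, h2⟩ := DNLS.exists_growing_mode (DNLS.inner_LplusOp hσ ω φ)
      (DNLS.inner_LminusOp hσ ω φ) hpos hω (DNLS.freeOp_coercive ω)
      (Kp := (2 * σ + 1) • DNLS.potential hσ φ) (hcomp.smul (2 * σ + 1)) hcomp rfl rfl hφ0 hLm
      (fun y hy => DNLS.exists_smul_of_LminusOp_eq_zero hσ hpos hφ0 hLm hy) hxφ hx
    exact DNLS.not_spectrallyStable_of_mode hσ hμ hf h1 h2
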